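/- A \emph{sandpile} $S$ is a finite connected loopless multigraph with a distinguished vertex $s$ (the sink) which stays connected and non-empty when $s$ is removed. A configuration assigns a number of particles to every non-sink vertex; a non-sink vertex $v$ holding at least $\deg(v)$ particles is unstable and may topple, sending one particle along each incident edge (particles sent to $s$ are lost). A configuration is \emph{recurrent} if it can be reached from every configuration by adding particles and then toppling unstable vertices. The \emph{transience class} $\mathrm{tcl}(S)\in\mathbb N\cup\{\infty\}$ is the maximal number of particles that can be added one by one to the empty configuration, stabilizing after each addition, before a recurrent configuration is reached. A family $\{S_n\}_{n\in\mathbb N}$ belongs to $TCL(\mathrm{poly}(n))$ if $\mathrm{tcl}(S_n)=O(n^k)$ for some $k$. For a vertex $w\ne s$, the potential $\pi_w$ of $S$ is the function with $\pi_w(s)=0$, $\pi_w(w)=1$ that is harmonic at all other vertices (unit resistance on every edge). Two sandpiles are \emph{network equivalent}, $S_1\sim_e S_2$, if their boundary sets (the vertices adjacent to the sink) can be identified so that $\pi_v(w)$ is the same in both for all boundary vertices $v,w$. (1) Let $\{A_n\}$, $\{B_n\}$ be families of sandpiles whose numbers of edges are bounded by polynomials in $n$. If $A_n\sim_e B_n$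 for all $n$, then $\{A_n\}\in TCL(\mathrm{poly}(n))$ if and only if $\{B_n\}\in TCL(\mathrm{poly}(n))$. (2) Let $L\sqcup R$ be the bipartition of the honeycomb lattice: $L$ is the vertex set of a triangular lattice, and each $q\in R$ is the centre of a star whose three leaves form an elementary triangle of $L$, every edge of the triangular lattice lying in exactly one of these triangles. For a finite set $F$ of vertices inducing a connected subgraph of the honeycomb lattice let $H_F$ be the sandpile on $F$ in which every lattice edge leaving $F$ is connected to the sink. For an integer $r\ge1$ let $T^{(r)}_F$ be the multigraph with sink on $F\cap L$ obtained from $H_F$ by replacing every star with centre in $F\cap R$ by the triangle on its leaves (leaves outside $F$ being the sink; edges from the sink to itself are dropped), and every remaining edge, from a vertex of $F\cap L$ to the sink, by $r$ parallel edges. Then: (a) For every such $F$ and all $v,w\in F\cap L$, the potential $\pi_w(v)$ is the same in $H_F$ and in $T^{(3)}_F$. (b) For every sequence $(F_n)$ of such sets and every fixed $r\ge 1$, $\{H_{F_n}\}\in TCL(\mathrm{poly}(n))$ if and only if $\{T^{(r)}_{F_n}\}\in TCL(\mathrm{poly}(n))$. (c) If moreover every centre $q\in R$ with at least two leaves in $F_n$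 belongs to $F_n$, for all $n$, then $\{H_{F_n}\}\in TCL(\mathrm{poly}(n))$ if and only if $\{T_n\}\in TCL(\mathrm{poly}(n))$, where $T_n$ is the sandpile on the section $F_n\cap L$ of the triangular lattice in which every lattice edge leaving the section is connected to the sink. -/

import Mathlib

/-- A finite multigraph without loops on the vertex set `V`, with a distinguished vertex, the sink.
`mult u v` is the number of parallel edges joining `u` and `v`. -/
structure SinkGraph (V : Type*) where
  mult : V → V → ℕ
  mult_comm : ∀ u v, mult u v = mult v u
  mult_self : ∀ v, mult v v = 0
  sink : V

namespace SinkGraph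

variable {V : Type*}

/-- The simple graph of adjacency. -/
def adjGraph (S : SinkGraph V) : SimpleGraph V where
  Adj u v := 0 < S.mult u v
  symm := ⟨fun u v h => by rw [S.mult_comm v u]; exact h⟩
  loopless := ⟨fun v h => by rw [S.mult_self v] at h; exact absurd h (lt_irrefl 0)⟩

/-- The underlying graph of a sandpile is connected. -/
def IsConnected (S : SinkGraph V) : Prop := S.adjGraph.Connected

/-- The ordinary (non-sink) vertices. -/
abbrev Site (S : SinkGraph V) : Type _ := {v : V // v ≠ S.sink}

/-- The graph stays connected (and non-empty) after the removal of the sink. -/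
def OrdinaryConnected (S : SinkGraph V) : Prop :=
  (S.adjGraph.induce {v | v ≠ S.sink}).Connected

/-- The boundary set: the vertices adjacent to the sink. -/
abbrev Boundary (S : SinkGraph V) : Type _ := {v : V // 0 < S.mult v S.sink}

section Finite

variable [Fintype V]

/-- The degree, counting parallel edges. -/
def degree (S : SinkGraph V) (v : V) : ℕ := ∑ u, S.mult v u

/-- The number of edges, counting parallel edges (half the sum of the degrees). -/
def numEdges (S : SinkGraph V) : ℕ := (∑ v, S.degree v) / 2

/-! ### Potentials -/

/-- `p` is the potential that appears in the circuit with a unit resistor on every edge when unit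
potential is applied at `w` and the sink is grounded: `p` is harmonic at all other vertices. -/
def IsPotential (S : SinkGraph V) (w : V) (p : V → ℝ) : Prop :=
  p S.sink = 0 ∧ p w = 1 ∧
    ∀ v, v ≠ S.sink → v ≠ w → ∑ u, (S.mult v u : ℝ) * p u = (S.degree v : ℝ) * p v

/-- Network equivalence: after an identification of the two boundary sets, unit potential applied
at any boundary vertex (with the sink grounded) produces the same potentials at all boundary
vertices. -/
def NetworkEquiv {W : Type*} [Fintype W] (S : SinkGraph V) (T : SinkGraph W) : Prop :=
  ∃ e : S.Boundary ≃ T.Boundary, ∀ v : S.Boundary, ∃ (p : V → ℝ) (q : W → ℝ),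
    S.IsPotential v.1 p ∧ T.IsPotential (e v).1 q ∧ ∀ w : S.Boundary, p w.1 = q (e w).1

/-! ### The abelian sandpile model -/

variable [DecidableEq V]

/-- A configuration: the number of particles at each ordinary vertex. -/
abbrev Config (S : SinkGraph V) : Type _ := S.Site → ℕ

/-- The site `v` is unstable. -/
def Unstable (S : SinkGraph V) (c : S.Config) (v : S.Site) : Prop := S.degree v.1 ≤ c v

/-- No site is unstable. -/
def IsStable (S : SinkGraph V) (c : S.Config) : Prop := ∀ v, ¬ S.Unstable c v

/-- Toppling `v`: it loses `degree v` particles, one along each incident edge. -/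
def topple (S : SinkGraph V) (c : S.Config) (v : S.Site) : S.Config :=
  fun u => if u = v then c v - S.degree v.1 else c u + S.mult v.1 u.1

/-- `d` arises from `c` by toppling one unstable site. -/
def ToppleStep (S : SinkGraph V) (c d : S.Config) : Prop :=
  ∃ v, S.Unstable c v ∧ d = S.topple c v

/-- There is a (possibly empty) toppling sequence from `c` to `d`. -/
def TopplesTo (S : SinkGraph V) : S.Config → S.Config → Prop :=
  Relation.ReflTransGen S.ToppleStep

/-- `d` is reachable from `c` by adding particles and toppling. -/
def Reachable (S : SinkGraph V) (c d : S.Config) : Prop :=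
  ∃ c', c ≤ c' ∧ S.TopplesTo c' d

/-- A configuration is recurrent if it is reachable from every configuration. -/
def IsRecurrent (S : SinkGraph V) (c : S.Config) : Prop := ∀ c', S.Reachable c' c

/-- `TransientRun k c`: starting from the empty configuration, `k` particles can be added one by
one, at sites of our choice and stabilizing after each addition, so that no recurrent configuration
has been met and the present stable configuration is `c`. -/
inductive TransientRun (S : SinkGraph V) : ℕ → S.Config → Prop
  | empty : ¬ S.IsRecurrent 0 → TransientRun S 0 0
  | add {k : ℕ} {c d : S.Config} (v : S.Site) : TransientRun S k c →
      S.TopplesTo (c + Pi.single v 1) d → S.IsStable d → ¬ S.IsRecurrent d →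
      TransientRun S (k + 1) d

/-- The transience class: the maximal number of particles that can be added before a recurrent
configuration is reached (`⊤` if there is no bound). -/
noncomputable def tcl (S : SinkGraph V) : ℕ∞ :=
  ⨆ k ∈ {k : ℕ | ∃ c, S.TransientRun k c}, (k : ℕ∞)

end Finite

/-! ### Families -/

section Family

variable {V : ℕ → Type*} [∀ n, Fintype (V n)]

/-- The numbers of edges of the family are bounded by a polynomial in the index. -/
def PolySize (S : ∀ n, SinkGraph (V n)) : Prop :=
  ∃ k C : ℕ, ∀ᶠ n in Filter.atTop, (S n).numEdges ≤ C * n ^ k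

variable [∀ n, DecidableEq (V n)]

/-- The family belongs to `TCL(f(n))`: `tcl (S n) = O(f n)`. -/
def InTCL (S : ∀ n, SinkGraph (V n)) (f : ℕ → ℕ) : Prop :=
  ∃ C : ℕ, ∀ᶠ n in Filter.atTop, (S n).tcl ≤ ((C * f n : ℕ) : ℕ∞)

/-- The family belongs to `TCL(poly(n))`. -/
def InTCLPoly (S : ∀ n, SinkGraph (V n)) : Prop := ∃ k : ℕ, InTCL S (fun n => n ^ k)

end Family

end SinkGraph

/-! ### The honeycomb and the triangular lattice -/

/-- The vertices of the honeycomb lattice. The two classes of the bipartition are two copies of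
`ℤ × ℤ`. The left copy is a triangular lattice, and each vertex of the right copy is the centre of
a star with three leaves in the left copy. -/
abbrev HoneycombSite : Type := (ℤ × ℤ) ⊕ (ℤ × ℤ)

/-- The three leaves of the star with centre `q`: an elementary triangle of the triangular
lattice. -/
def starLeaves (q : ℤ × ℤ) : Finset (ℤ × ℤ) := {q, q + (1, 0), q + (0, 1)}

/-- The three centres of the stars with `p` as a leaf. -/
def starCentres (p : ℤ × ℤ) : Finset (ℤ × ℤ) := {p, p - (1, 0), p - (0, 1)}

theorem mem_starCentres_iff (p q : ℤ × ℤ) : q ∈ starCentres p ↔ p ∈ starLeaves q := by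
  obtain ⟨a, b⟩ := p
  obtain ⟨c, d⟩ := q
  simp only [starCentres, starLeaves, Finset.mem_insert, Finset.mem_singleton, Prod.mk.injEq,
    Prod.mk_add_mk, Prod.mk_sub_mk]
  omega

/-- The three neighbours of a vertex in the honeycomb lattice. -/
def honeycombNbrs : HoneycombSite → Finset HoneycombSite
  | .inl p => (starCentres p).map Function.Embedding.inr
  | .inr q => (starLeaves q).map Function.Embedding.inl

theorem honeycombNbrs_comm (u v : HoneycombSite) :
    v ∈ honeycombNbrs u ↔ u ∈ honeycombNbrs v := by
  rcases u with p | q <;> rcases v with p' | q' <;>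
    simp [honeycombNbrs, mem_starCentres_iff]

theorem honeycombNbrs_self (u : HoneycombSite) : u ∉ honeycombNbrs u := by
  rcases u with p | q <;> simp [honeycombNbrs]

/-- The honeycomb lattice. -/
def honeycomb : SimpleGraph HoneycombSite where
  Adj u v := v ∈ honeycombNbrs u
  symm := ⟨fun u v h => (honeycombNbrs_comm u v).1 h⟩
  loopless := ⟨honeycombNbrs_self⟩

/-- The six neighbours of a point in the triangular lattice. -/
def triangularNbrs (p : ℤ × ℤ) : Finset (ℤ × ℤ) :=
  {p + (1, 0), p - (1, 0), p + (0, 1), p - (0, 1), p + (1, -1), p - (1, -1)}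

theorem triangularNbrs_comm (p q : ℤ × ℤ) : q ∈ triangularNbrs p ↔ p ∈ triangularNbrs q := by
  obtain ⟨a, b⟩ := p
  obtain ⟨c, d⟩ := q
  simp only [triangularNbrs, Finset.mem_insert, Finset.mem_singleton, Prod.mk.injEq,
    Prod.mk_add_mk, Prod.mk_sub_mk]
  omega

theorem triangularNbrs_self (p : ℤ × ℤ) : p ∉ triangularNbrs p := by
  obtain ⟨a, b⟩ := p
  simp only [triangularNbrs, Finset.mem_insert, Finset.mem_singleton, Prod.mk.injEq,
    Prod.mk_add_mk, Prod.mk_sub_mk]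
  omega

/-- The sandpile with site set `X` and sink `none`, given the edges between sites and the number of
edges from each site to the sink. -/
def SinkGraph.ofSites {X : Type*} (m : X → X → ℕ) (t : X → ℕ)
    (hm : ∀ x y, m x y = m y x) (h0 : ∀ x, m x x = 0) : SinkGraph (Option X) where
  mult
    | some x, some y => m x y
    | some x, none => t x
    | none, some y => t y
    | none, none => 0
  mult_comm u v := by cases u <;> cases v <;> simp [hm]
  mult_self v := by cases v <;> simp [h0]
  sink := none

/-- The honeycomb sandpile on the finite section `F` of the honeycomb lattice: the edges that leave
`F` are connected to the sink. -/
def honeycombSandpile (F : Finset HoneycombSite) : SinkGraph (Option F) :=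
  SinkGraph.ofSites (fun u v => if v.1 ∈ honeycombNbrs u.1 then 1 else 0)
    (fun u => ((honeycombNbrs u.1).filter (· ∉ F)).card)
    (fun u v => by simp [honeycombNbrs_comm u.1 v.1])
    (fun u => by simp [honeycombNbrs_self])

/-- The triangular sandpile on the finite section `P` of the triangular lattice: the edges that
leave `P` are connected to the sink. -/
def triangularSandpile (P : Finset (ℤ × ℤ)) : SinkGraph (Option P) :=
  SinkGraph.ofSites (fun u v => if v.1 ∈ triangularNbrs u.1 then 1 else 0)
    (fun u => ((triangularNbrs u.1).filter (· ∉ P)).card)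
    (fun u v => by simp [triangularNbrs_comm u.1 v.1])
    (fun u => by simp [triangularNbrs_self])

/-- The sandpile obtained from `honeycombSandpile F` by the star-delta transformation. Every star
whose centre lies in `F` is replaced by the triangle on its three leaves (leaves outside `F` being
the sink), with one edge for each side. The edges that belong to no such star are those that join a
left vertex of `F` to the sink in place of a centre outside `F`; each of them is replaced by
`r` parallel edges. -/
def starDeltaSandpile (r : ℕ) (F : Finset HoneycombSite) : SinkGraph (Option F.toLeft) :=
  SinkGraph.ofSites
    (fun u v => if u = v then 0 else
      (F.toRight.filter (fun q => u.1 ∈ starLeaves q ∧ v.1 ∈ starLeaves q)).card)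
    (fun u => ∑ q ∈ starCentres u.1,
      if q ∈ F.toRight then ((starLeaves q).filter (· ∉ F.toLeft)).card else r)
    (fun u v => by simp only [eq_comm (a := u), and_comm (a := u.1 ∈ _)])
    (fun u => by simp)

/-! The transience class is, up to polynomial factors, the reciprocal of the smallest potential
`π_w(v)`; all three statements then reduce to comparing potentials.

Pair a configuration with `π_w`. Toppling any site other than `w` preserves this weight, and
toppling `w` does not increase it. If all potentials are at least `1 / M`, then as long as `w` has
not toppled, `k` added particles weigh at least `k / M`, while a stable configuration weighs at most
the sum of the degrees. Once every site has toppled there is no forbidden subconfiguration, which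
implies recurrence. This gives `tcl_le_of_potential`. Conversely, drop all particles at `v`: after
`K + 1` of them the weight is at most `(K + 1) * π_w(v)`, yet a recurrent configuration has a
particle at `w` or at any given neighbouring site, so its weight is at least the reciprocal of the
maximal degree. This gives `one_le_mul_potential`.

For network equivalence, boundary potentials bound all potentials from below
(`potential_ge_of_boundary`): the minimum over the sites is attained at the boundary, and
reciprocity exchanges source and target at the cost of a ratio of conductances.

For the lattices, eliminating the star centres turns honeycomb potentials into those of the
star-delta network with three edges in place of each remaining one. Passing from 3 to `r` changes
only conductances to the sink. Multiplying these by at most `K` lowers a potential `p`, but not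
below `p ^ K`, because `p ^ K` is subharmonic for the new network. No bound on the size is assumed
here: the transience class itself bounds the number of sites (`card_site_le`). For sections
containing all centres with two leaves inside, `r = 2` is the triangular sandpile. -/

namespace SinkGraph

open Finset

/-! ### The Laplacian and the maximum principle -/

section Laplacian

variable {V : Type*} [Fintype V]

/-- The combinatorial Laplacian. -/
def lap (S : SinkGraph V) (f : V → ℝ) (v : V) : ℝ :=
  S.degree v * f v - ∑ u, (S.mult v u : ℝ) * f u

theorem lap_eq_sum (S : SinkGraph V) (f : V → ℝ) (v : V) :
    S.lap f v = ∑ u, (S.mult v u : ℝ) * (f v - f u) := by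
  simp only [lap, degree, Nat.cast_sum, sum_mul, ← sum_sub_distrib, mul_sub]

theorem lap_add (S : SinkGraph V) (f g : V → ℝ) (v : V) :
    S.lap (f + g) v = S.lap f v + S.lap g v := by
  simp only [lap_eq_sum, ← sum_add_distrib, Pi.add_apply]
  exact sum_congr rfl fun u _ => by ring

theorem lap_smul (S : SinkGraph V) (a : ℝ) (f : V → ℝ) (v : V) :
    S.lap (a • f) v = a * S.lap f v := by
  simp only [lap_eq_sum, mul_sum, Pi.smul_apply, smul_eq_mul]
  exact sum_congr rfl fun u _ => by ring

theorem lap_sub (S : SinkGraph V) (f g : V → ℝ) (v : V) :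
    S.lap (f - g) v = S.lap f v - S.lap g v := by
  simp only [lap_eq_sum, ← sum_sub_distrib, Pi.sub_apply]
  exact sum_congr rfl fun u _ => by ring

/-- The Laplacian is symmetric. -/
theorem sum_mul_lap_comm (S : SinkGraph V) (f g : V → ℝ) :
    ∑ v, f v * S.lap g v = ∑ v, g v * S.lap f v := by
  have key : ∀ a b : V → ℝ, ∑ v, a v * S.lap b v =
      ∑ v, (S.degree v : ℝ) * (a v * b v) - ∑ v, ∑ u, (S.mult v u : ℝ) * (a v * b u) := by
    intro a b
    simp only [lap, ← sum_sub_distrib]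
    refine sum_congr rfl fun v _ => ?_
    rw [mul_sub, mul_sum]
    congr 1
    · ring
    · exact sum_congr rfl fun u _ => by ring
  rw [key f g, key g f]
  congr 1
  · exact sum_congr rfl fun v _ => by ring
  · rw [sum_comm]
    exact sum_congr rfl fun v _ => sum_congr rfl fun u _ => by rw [S.mult_comm u v]; ring

/-- The Dirichlet energy. -/
theorem sum_mult_mul_sq (S : SinkGraph V) (f : V → ℝ) :
    ∑ v, ∑ u, (S.mult v u : ℝ) * (f v - f u) ^ 2 = 2 * ∑ v, f v * S.lap f v := by
  have h1 : ∑ v, f v * S.lap f v = ∑ v, ∑ u, (S.mult v u : ℝ) * (f v * (f v - f u)) := by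
    refine sum_congr rfl fun v _ => ?_
    rw [lap_eq_sum, mul_sum]
    exact sum_congr rfl fun u _ => by ring
  have h2 : ∑ v, f v * S.lap f v = ∑ v, ∑ u, (S.mult v u : ℝ) * (f u * (f u - f v)) := by
    rw [h1, sum_comm]
    exact sum_congr rfl fun v _ => sum_congr rfl fun u _ => by rw [S.mult_comm u v]
  rw [two_mul]
  nth_rewrite 1 [h1]
  rw [h2, ← sum_add_distrib]
  refine sum_congr rfl fun v _ => ?_
  rw [← sum_add_distrib]
  exact sum_congr rfl fun u _ => by ring

/-- **Maximum principle**: a function that is nonnegative on a set containing the sink and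
superharmonic elsewhere is nonnegative. -/
theorem nonneg_of_superharmonic {S : SinkGraph V} (hS : S.IsConnected) {Z : Set V} {f : V → ℝ}
    (hs : S.sink ∈ Z) (hZ : ∀ v ∈ Z, 0 ≤ f v) (hf : ∀ v, v ∉ Z → 0 ≤ S.lap f v) (v : V) :
    0 ≤ f v := by
  have : Nonempty V := ⟨v⟩
  obtain ⟨x, hx⟩ := Finite.exists_min f
  by_contra! hv
  have hx0 : f x < 0 := (hx v).trans_lt hv
  -- At a negative minimum all terms of the Laplacian are nonpositive, so superharmonicity forces
  -- them to vanish: the minimum spreads along edges, and finally reaches the sink.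
  have hstep : ∀ a b, S.adjGraph.Adj a b → f a = f x → f b = f x := by
    intro a b hab ha
    have haZ : a ∉ Z := fun h => absurd (hZ a h) (by rw [ha]; exact not_le.2 hx0)
    have h := hf a haZ
    rw [lap_eq_sum] at h
    have hle : ∀ u ∈ univ, (S.mult a u : ℝ) * (f a - f u) ≤ 0 := fun u _ =>
      mul_nonpos_of_nonneg_of_nonpos (Nat.cast_nonneg _) (by rw [ha]; linarith [hx u])
    have h0 := (sum_eq_zero_iff_of_nonpos hle).1 (le_antisymm (sum_nonpos hle) h) b (mem_univ b)
    have hm : (S.mult a b : ℝ) ≠ 0 := by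
      have : 0 < S.mult a b := hab
      positivity
    have := (mul_eq_zero.1 h0).resolve_left hm
    linarith
  have hall : ∀ y, S.adjGraph.Reachable x y → f y = f x := by
    rintro y ⟨p⟩
    induction p with
    | nil => rfl
    | cons hadj p ih =>
      have h1 := hstep _ _ hadj rfl
      rw [← h1]
      apply ih
      · intro w; rw [h1]; exact hx w
      · rw [h1]; exact hx0
      · intro a b; rw [h1]; exact hstep a b
  have := hZ _ hs
  rw [hall _ (hS.preconnected x S.sink)] at this
  linarith

theorem eq_of_lap_eq {S : SinkGraph V} (hS : S.IsConnected) {Z : Set V} {f g : V → ℝ}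
    (hs : S.sink ∈ Z) (hZ : ∀ v ∈ Z, f v = g v) (hf : ∀ v, v ∉ Z → S.lap f v = S.lap g v) :
    f = g := by
  have h1 := nonneg_of_superharmonic (f := f - g) hS hs (fun v hv => by simp [hZ v hv])
    (fun v hv => by rw [lap_sub, hf v hv, sub_self])
  have h2 := nonneg_of_superharmonic (f := g - f) hS hs (fun v hv => by simp [hZ v hv])
    (fun v hv => by rw [lap_sub, hf v hv, sub_self])
  funext v
  have a := h1 v
  have b := h2 v
  simp only [Pi.sub_apply] at a b
  linarith

/-- Solvability of the Dirichlet problem. -/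
theorem exists_lap_eq {S : SinkGraph V} (hS : S.IsConnected) {Z : Set V} (hs : S.sink ∈ Z)
    (g : V → ℝ) : ∃ f : V → ℝ, (∀ v ∈ Z, f v = g v) ∧ ∀ v, v ∉ Z → S.lap f v = g v := by
  classical
  let T : (V → ℝ) →ₗ[ℝ] (V → ℝ) :=
    { toFun := fun f v => if v ∈ Z then f v else S.lap f v
      map_add' := fun f g => by
        funext v; by_cases h : v ∈ Z <;> simp [h, lap_add]
      map_smul' := fun a f => by
        funext v; by_cases h : v ∈ Z <;> simp [h, lap_smul] }
  have hT : ∀ f v, T f v = if v ∈ Z then f v else S.lap f v := fun _ _ => rfl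
  -- Uniqueness gives existence: `T` is an endomorphism of a finite-dimensional space.
  have hinj : Function.Injective T := by
    intro f g hfg
    refine eq_of_lap_eq hS hs (fun v hv => ?_) (fun v hv => ?_)
    · simpa [hT, hv] using congrFun hfg v
    · simpa [hT, hv] using congrFun hfg v
  obtain ⟨f, hf⟩ := LinearMap.injective_iff_surjective.1 hinj g
  refine ⟨f, fun v hv => ?_, fun v hv => ?_⟩
  · simpa [hT, hv] using congrFun hf v
  · simpa [hT, hv] using congrFun hf v

theorem degree_pos {S : SinkGraph V} (hS : S.IsConnected) {v : V} (hv : v ≠ S.sink) :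
    0 < S.degree v := by
  have : Nontrivial V := ⟨⟨v, S.sink, hv⟩⟩
  obtain ⟨u, hu⟩ := hS.preconnected.exists_adj_of_nontrivial v
  exact (show 0 < S.mult v u from hu).trans_le
    (single_le_sum (f := fun u => S.mult v u) (fun _ _ => Nat.zero_le _) (mem_univ u))

/-! ### Potentials -/

theorem isPotential_iff {S : SinkGraph V} {w : V} {p : V → ℝ} :
    S.IsPotential w p ↔ p S.sink = 0 ∧ p w = 1 ∧ ∀ v, v ≠ S.sink → v ≠ w → S.lap p v = 0 := by
  simp only [IsPotential, lap, sub_eq_zero, eq_comm (a := Finset.sum _ _)]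

theorem exists_isPotential {S : SinkGraph V} (hS : S.IsConnected) {w : V} (hw : w ≠ S.sink) :
    ∃ p, S.IsPotential w p := by
  classical
  obtain ⟨p, hp, hp'⟩ := exists_lap_eq (Z := {S.sink, w}) hS (by simp) (Pi.single w 1)
  refine ⟨p, isPotential_iff.2 ⟨?_, ?_, ?_⟩⟩
  · rw [hp _ (by simp), Pi.single_eq_of_ne hw.symm]
  · rw [hp _ (by simp), Pi.single_eq_same]
  · intro v hv hvw
    rw [hp' v (by simp [hv, hvw]), Pi.single_eq_of_ne hvw]

theorem IsPotential.nonneg {S : SinkGraph V} (hS : S.IsConnected) {w : V} {p : V → ℝ}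
    (hp : S.IsPotential w p) (v : V) : 0 ≤ p v := by
  obtain ⟨h0, h1, h⟩ := isPotential_iff.1 hp
  refine nonneg_of_superharmonic (Z := {S.sink, w}) hS (by simp) ?_ ?_ v
  · rintro x (rfl | rfl)
    · exact h0.ge
    · rw [h1]; exact zero_le_one
  · intro x hx
    simp only [Set.mem_insert_iff, Set.mem_singleton_iff, not_or] at hx
    exact (h x hx.1 hx.2).ge

theorem IsPotential.le_one {S : SinkGraph V} (hS : S.IsConnected) {w : V} {p : V → ℝ}
    (hp : S.IsPotential w p) (v : V) : p v ≤ 1 := by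
  obtain ⟨h0, h1, h⟩ := isPotential_iff.1 hp
  have := nonneg_of_superharmonic (Z := {S.sink, w}) (f := (fun _ => 1) - p) hS (by simp) ?_ ?_ v
  · simpa using this
  · rintro x (rfl | rfl)
    · simp [h0]
    · simp [h1]
  · intro x hx
    simp only [Set.mem_insert_iff, Set.mem_singleton_iff, not_or] at hx
    rw [lap_sub, h x hx.1 hx.2]
    simp [lap_eq_sum]

/-- Comparison of a subharmonic function with a potential. -/
theorem IsPotential.ge_of_subharmonic {S : SinkGraph V} (hS : S.IsConnected) {w : V} {p f : V → ℝ}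
    (hp : S.IsPotential w p) (hf0 : f S.sink ≤ 0) (hf1 : f w ≤ 1)
    (hf : ∀ v, v ≠ S.sink → v ≠ w → S.lap f v ≤ 0) (v : V) : f v ≤ p v := by
  obtain ⟨h0, h1, h⟩ := isPotential_iff.1 hp
  have := nonneg_of_superharmonic (Z := {S.sink, w}) (f := p - f) hS (by simp) ?_ ?_ v
  · simpa using this
  · rintro x (rfl | rfl)
    · simp [h0, hf0]
    · simp [h1, hf1]
  · intro x hx
    simp only [Set.mem_insert_iff, Set.mem_singleton_iff, not_or] at hx
    rw [lap_sub, h x hx.1 hx.2]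
    simpa using hf x hx.1 hx.2

/-- One step of the walk: a potential is at least `1 / degree` times its value at a neighbour. -/
theorem IsPotential.mul_le_degree_mul {S : SinkGraph V} (hS : S.IsConnected) {w : V} {p : V → ℝ}
    (hp : S.IsPotential w p) {v : V} (hv : v ≠ S.sink) (hvw : v ≠ w) {u : V}
    (hu : 0 < S.mult v u) : p u ≤ S.degree v * p v := by
  rw [← hp.2.2 v hv hvw]
  refine le_trans ?_ (single_le_sum (f := fun u => (S.mult v u : ℝ) * p u)
    (fun x _ => mul_nonneg (Nat.cast_nonneg _) (hp.nonneg hS x)) (mem_univ u))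
  exact le_mul_of_one_le_left (hp.nonneg hS u) (by exact_mod_cast hu)

/-- Markov property. -/
theorem IsPotential.mul_le {S : SinkGraph V} (hS : S.IsConnected) {w x : V} {p q : V → ℝ}
    (hp : S.IsPotential w p) (hq : S.IsPotential x q) (v : V) : p x * q v ≤ p v := by
  obtain ⟨h0, h1, h⟩ := isPotential_iff.1 hp
  obtain ⟨k0, k1, k⟩ := isPotential_iff.1 hq
  have := nonneg_of_superharmonic (Z := {S.sink, w, x}) (f := p - p x • q) hS (by simp) ?_ ?_ v
  · simpa using this
  · rintro y (rfl | rfl | rfl)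
    · simp [h0, k0]
    · simp only [Pi.sub_apply, Pi.smul_apply, smul_eq_mul, h1, sub_nonneg]
      exact mul_le_one₀ (hp.le_one hS x) (hq.nonneg hS y) (hq.le_one hS y)
    · simp [k1]
  · intro y hy
    simp only [Set.mem_insert_iff, Set.mem_singleton_iff, not_or] at hy
    rw [lap_sub, lap_smul, h y hy.1 hy.2.1, k y hy.1 hy.2.2]
    simp

/-- The minimum of a potential over the sites is attained at the boundary. -/
theorem IsPotential.ge_of_boundary {S : SinkGraph V} (hS : S.IsConnected) {w : V} {p : V → ℝ}
    (hp : S.IsPotential w p) {ε : ℝ} (hε : ε ≤ 1) (hb : ∀ b, 0 < S.mult b S.sink → ε ≤ p b)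
    {v : V} (hv : v ≠ S.sink) : ε ≤ p v := by
  classical
  obtain ⟨h0, h1, h⟩ := isPotential_iff.1 hp
  -- Subtracting `ε` everywhere would be negative at the sink. Resetting the value there to `0`
  -- affects the Laplacian only at neighbours of the sink, which lie in `Z`.
  have := nonneg_of_superharmonic (Z := {x | x = S.sink ∨ x = w ∨ 0 < S.mult x S.sink})
    (f := fun x => if x = S.sink then 0 else p x - ε) hS (Or.inl rfl) ?_ ?_ v
  · simpa [hv] using this
  · intro x hx
    split_ifs with hxs
    · exact le_rfl
    · rcases hx with hx | rfl | hx
      · exact absurd hx hxs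
      · rw [h1]; linarith
      · linarith [hb x hx]
  · intro x hx
    simp only [Set.mem_ofPred_eq, not_or, Nat.pos_iff_ne_zero, not_not] at hx
    rw [← h x hx.1 hx.2.1, lap_eq_sum, lap_eq_sum]
    refine (sum_congr rfl fun u _ => ?_).le
    by_cases hu : u = S.sink
    · simp [hu, hx.2.2]
    · simp [hu, hx.1]

/-- Reciprocity. -/
theorem IsPotential.reciprocity {S : SinkGraph V} {w v : V} {p q : V → ℝ}
    (hp : S.IsPotential w p) (hq : S.IsPotential v q) :
    p v * S.lap q v = q w * S.lap p w := by
  obtain ⟨h0, h1, h⟩ := isPotential_iff.1 hp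
  obtain ⟨k0, k1, k⟩ := isPotential_iff.1 hq
  have := S.sum_mul_lap_comm p q
  rwa [sum_eq_single v, sum_eq_single w] at this
  · intro x _ hx
    by_cases hs : x = S.sink
    · rw [hs, k0, zero_mul]
    · rw [h x hs hx, mul_zero]
  · simp
  · intro x _ hx
    by_cases hs : x = S.sink
    · rw [hs, h0, zero_mul]
    · rw [k x hs hx, mul_zero]
  · simp

theorem IsPotential.lap_le_degree {S : SinkGraph V} (hS : S.IsConnected) {w : V} {p : V → ℝ}
    (hp : S.IsPotential w p) : S.lap p w ≤ S.degree w := by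
  rw [lap, hp.2.1, mul_one, sub_le_self_iff]
  exact sum_nonneg fun x _ => mul_nonneg (Nat.cast_nonneg _) (hp.nonneg hS x)

/-- The effective conductance between a site and the sink is at least `1 / |V| ^ 2`. -/
theorem IsPotential.one_le_card_sq_mul_lap {S : SinkGraph V} (hS : S.IsConnected) {w : V}
    {p : V → ℝ} (hp : S.IsPotential w p) : 1 ≤ (Fintype.card V : ℝ) ^ 2 * S.lap p w := by
  classical
  obtain ⟨h0, h1, h⟩ := isPotential_iff.1 hp
  have hE : ∑ v, p v * S.lap p v = S.lap p w := by
    rw [sum_eq_single w, h1, one_mul]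
    · intro x _ hx
      by_cases hs : x = S.sink
      · rw [hs, h0, zero_mul]
      · rw [h x hs hx, mul_zero]
    · simp
  have hD := S.sum_mult_mul_sq p
  rw [hE] at hD
  set N : ℝ := (Fintype.card V : ℝ) with hN
  have hNpos : 0 < N := by
    have : Nonempty V := ⟨w⟩
    rw [hN]; exact_mod_cast Fintype.card_pos
  have hα : 0 ≤ S.lap p w := by
    have : 0 ≤ ∑ v, ∑ u, (S.mult v u : ℝ) * (p v - p u) ^ 2 :=
      sum_nonneg fun _ _ => sum_nonneg fun _ _ => by positivity
    linarith
  -- The double sum counts every edge twice, so a single edge dissipates at most the total energy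
  -- `S.lap p w`. The total drop 1 along a path to the sink then bounds this energy from below.
  have hpair : ∀ a b, S.adjGraph.Adj a b → (p a - p b) ^ 2 ≤ S.lap p w := by
    intro a b hab
    have hab' : (1 : ℝ) ≤ S.mult a b := by exact_mod_cast (show 0 < S.mult a b from hab)
    have hne : a ≠ b := hab.ne
    have hrow : ∀ x y, (S.mult x y : ℝ) * (p x - p y) ^ 2 ≤
        ∑ u, (S.mult x u : ℝ) * (p x - p u) ^ 2 := fun x y =>
      single_le_sum (f := fun u => (S.mult x u : ℝ) * (p x - p u) ^ 2)
        (fun _ _ => by positivity) (mem_univ y)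
    have htwo : ∑ x ∈ {a, b}, ∑ u, (S.mult x u : ℝ) * (p x - p u) ^ 2 ≤
        ∑ x, ∑ u, (S.mult x u : ℝ) * (p x - p u) ^ 2 :=
      sum_le_sum_of_subset_of_nonneg (subset_univ _)
        fun _ _ _ => sum_nonneg fun _ _ => by positivity
    rw [sum_pair hne] at htwo
    have ha := hrow a b
    have hb := hrow b a
    rw [S.mult_comm b a] at hb
    nlinarith [sq_nonneg (p a - p b)]
  obtain ⟨P, hP⟩ := hS.preconnected.exists_isPath w S.sink
  have hwalk : ∀ (x y : V) (W : S.adjGraph.Walk x y),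
      p x - p y ≤ W.length * Real.sqrt (S.lap p w) := by
    intro x y W
    induction W with
    | nil => simp
    | cons hadj W ih =>
      have := Real.le_sqrt_of_sq_le (hpair _ _ hadj)
      rw [SimpleGraph.Walk.length_cons]
      push_cast
      linarith
  have hlast := hwalk w S.sink P
  rw [h0, h1, sub_zero] at hlast
  have hlen : (P.length : ℝ) ≤ N := by
    rw [hN]; exact_mod_cast hP.length_lt.le
  have h2 : 1 ≤ N * Real.sqrt (S.lap p w) :=
    hlast.trans (mul_le_mul_of_nonneg_right hlen (Real.sqrt_nonneg _))
  calc (1 : ℝ) ≤ (N * Real.sqrt (S.lap p w)) ^ 2 := one_le_pow₀ h2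
    _ = N ^ 2 * S.lap p w := by rw [mul_pow, Real.sq_sqrt hα]

/-- Lower bounds for the potentials at the boundary imply lower bounds everywhere. -/
theorem potential_ge_of_boundary {S : SinkGraph V} (hS : S.IsConnected) {ε D : ℝ} (hε0 : 0 ≤ ε)
    (hε : ε ≤ 1) (hD : 1 ≤ D) (hcard : Fintype.card V ≤ D) (hdeg : ∀ v, (S.degree v : ℝ) ≤ D)
    (hb : ∀ b, 0 < S.mult b S.sink → ∃ p, S.IsPotential b p ∧
      ∀ b', 0 < S.mult b' S.sink → ε ≤ p b')
    {w v : V} {p : V → ℝ} (hw : w ≠ S.sink) (hv : v ≠ S.sink) (hp : S.IsPotential w p) :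
    ε ≤ D ^ 3 * p v := by
  have hD0 : 0 < D := by linarith
  have hα := hp.one_le_card_sq_mul_lap hS
  have hα' : 1 ≤ D ^ 2 * S.lap p w := by
    have h0 : 0 ≤ S.lap p w := by
      by_contra! h
      have : (Fintype.card V : ℝ) ^ 2 * S.lap p w ≤ 0 :=
        mul_nonpos_of_nonneg_of_nonpos (by positivity) h.le
      linarith
    exact hα.trans (mul_le_mul_of_nonneg_right (by gcongr) h0)
  -- Two factors `D` come from the lower bound for the conductance at `w`, the third from the upper
  -- bound `degree b ≤ D` for the conductance at `b`.
  have key : ε / D ^ 3 ≤ p v := by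
    refine hp.ge_of_boundary hS ?_ ?_ hv
    · rw [div_le_one (by positivity)]
      exact hε.trans (one_le_pow₀ hD)
    · intro b hbs
      obtain ⟨q, hq, hqb⟩ := hb b hbs
      have hqw : ε ≤ q w := hq.ge_of_boundary hS hε hqb hw
      have hrec := hp.reciprocity hq
      have hle : p b * S.lap q b ≤ p b * D :=
        mul_le_mul_of_nonneg_left ((hq.lap_le_degree hS).trans (hdeg b)) (hp.nonneg hS b)
      rw [div_le_iff₀ (by positivity)]
      have hα0 : 0 < S.lap p w := by
        by_contra! h
        have : D ^ 2 * S.lap p w ≤ 0 := mul_nonpos_of_nonneg_of_nonpos (by positivity) h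
        linarith
      calc ε ≤ ε * (D ^ 2 * S.lap p w) := le_mul_of_one_le_right hε0 hα'
        _ = D ^ 2 * (ε * S.lap p w) := by ring
        _ ≤ D ^ 2 * (q w * S.lap p w) := by gcongr
        _ ≤ D ^ 2 * (p b * D) := by rw [← hrec]; gcongr
        _ = p b * D ^ 3 := by ring
  rw [div_le_iff₀ (by positivity)] at key
  linarith

end Laplacian

end SinkGraph

namespace SinkGraph

open Finset

section Dynamics

variable {V : Type*} [Fintype V] [DecidableEq V]

/-! ### Stabilization -/

/-- The pairing of a configuration with a function on the vertices. -/
def weight (S : SinkGraph V) (f : V → ℝ) (c : S.Config) : ℝ := ∑ v, (c v : ℝ) * f v.1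

theorem weight_nonneg (S : SinkGraph V) {f : V → ℝ} (hf : ∀ v, 0 ≤ f v) (c : S.Config) :
    0 ≤ S.weight f c :=
  sum_nonneg fun v _ => mul_nonneg (Nat.cast_nonneg _) (hf v)

theorem weight_add_single (S : SinkGraph V) (f : V → ℝ) (c : S.Config) (v : S.Site) :
    S.weight f (c + Pi.single v 1) = S.weight f c + f v.1 := by
  simp [weight, add_mul, sum_add_distrib, Pi.single_apply]

theorem mul_le_weight (S : SinkGraph V) {f : V → ℝ} (hf : ∀ v, 0 ≤ f v) (c : S.Config)
    (v : S.Site) : c v * f v.1 ≤ S.weight f c :=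
  single_le_sum (f := fun v : S.Site => (c v : ℝ) * f v.1)
    (fun v _ => mul_nonneg (Nat.cast_nonneg _) (hf v)) (mem_univ v)

theorem sum_site {M : Type*} [AddCommMonoid M] (S : SinkGraph V) (g : V → M)
    (hg : g S.sink = 0) : ∑ v : S.Site, g v.1 = ∑ v, g v := by
  rw [← sum_subtype (univ.filter (· ≠ S.sink)) (by simp) g, sum_filter]
  refine sum_congr rfl fun v _ => ?_
  by_cases h : v = S.sink <;> simp [h, hg]

theorem cast_topple (S : SinkGraph V) {c : S.Config} {v : S.Site} (h : S.Unstable c v)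
    (u : S.Site) : (S.topple c v u : ℝ) =
      c u + S.mult v.1 u.1 - if u = v then (S.degree v.1 : ℝ) else 0 := by
  unfold topple
  split_ifs with huv
  · subst huv
    rw [Nat.cast_sub h, S.mult_self]
    simp
  · simp

/-- Toppling `v` changes the weight by the Laplacian at `v`. -/
theorem weight_topple (S : SinkGraph V) {f : V → ℝ} (hf : f S.sink = 0) {c : S.Config}
    {v : S.Site} (h : S.Unstable c v) :
    S.weight f (S.topple c v) = S.weight f c - S.lap f v.1 := by
  simp only [weight, S.cast_topple h, sub_mul, add_mul, sum_sub_distrib, sum_add_distrib, ite_mul,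
    zero_mul, sum_ite_eq', mem_univ, if_true, lap]
  rw [S.sum_site (fun u => (S.mult v.1 u : ℝ) * f u) (by simp [hf])]
  ring

/-- Pairing with `h` gives a Lyapunov function that each toppling lowers by exactly one. Rounded
multiples of `h` also supply integer toppling vectors that produce arbitrarily many particles at
every site. -/
theorem exists_green {S : SinkGraph V} (hS : S.IsConnected) :
    ∃ h : V → ℝ, h S.sink = 0 ∧ (∀ v, 0 ≤ h v) ∧ ∀ v, v ≠ S.sink → S.lap h v = 1 := by
  obtain ⟨h, h0, h1⟩ := exists_lap_eq (Z := {S.sink}) hS rfl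
    (fun v => if v = S.sink then 0 else 1)
  have h0' : h S.sink = 0 := by simpa using h0 S.sink rfl
  have h1' : ∀ v, v ≠ S.sink → S.lap h v = 1 := fun v hv => by simpa [hv] using h1 v hv
  refine ⟨h, h0', fun v => ?_, h1'⟩
  refine nonneg_of_superharmonic (Z := {S.sink}) hS rfl ?_ ?_ v
  · rintro x rfl; exact h0'.ge
  · intro x hx; rw [h1' x hx]; exact zero_le_one

theorem exists_stabilization {S : SinkGraph V} (hS : S.IsConnected) (c : S.Config) :
    ∃ d, S.TopplesTo c d ∧ S.IsStable d := by
  obtain ⟨h, h0, hnn, h1⟩ := exists_green hS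
  suffices H : ∀ (n : ℕ) (c : S.Config), S.weight h c < n → ∃ d, S.TopplesTo c d ∧ S.IsStable d by
    obtain ⟨n, hn⟩ := exists_nat_gt (S.weight h c)
    exact H n c hn
  intro n
  induction n with
  | zero =>
    intro c hc
    have := S.weight_nonneg hnn c
    simp only [Nat.cast_zero] at hc
    linarith
  | succ n ih =>
    intro c hc
    by_cases hst : S.IsStable c
    · exact ⟨c, Relation.ReflTransGen.refl, hst⟩
    · simp only [IsStable, not_forall, not_not] at hst
      obtain ⟨v, hv⟩ := hst
      obtain ⟨d, hd, hd'⟩ := ih (S.topple c v) (by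
        rw [S.weight_topple h0 hv, h1 v.1 v.2]
        push_cast at hc
        linarith)
      exact ⟨d, Relation.ReflTransGen.head ⟨v, hv, rfl⟩ hd, hd'⟩

/-! ### Recurrent configurations -/

/-- In a recurrent configuration two adjacent sites are never both empty. -/
theorem IsRecurrent.pos_or_pos {S : SinkGraph V} {c : S.Config} (hc : S.IsRecurrent c)
    {a b : S.Site} (hab : 0 < S.mult a.1 b.1) : 0 < c a ∨ 0 < c b := by
  -- Starting with a particle everywhere, emptying one of `a`, `b` by a toppling sends a particle to
  -- the other.
  obtain ⟨c', hle, hT⟩ := hc (fun _ => 1)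
  clear hc
  have hne : a ≠ b := by
    rintro rfl
    rw [S.mult_self] at hab
    exact lt_irrefl _ hab
  induction hT with
  | refl => exact Or.inl (hle a)
  | tail _ hstep ih =>
    obtain ⟨v, hv, rfl⟩ := hstep
    by_cases hav : a = v
    · subst hav
      right
      simp only [topple, if_neg hne.symm]
      omega
    · by_cases hbv : b = v
      · subst hbv
        left
        rw [S.mult_comm] at hab
        simp only [topple, if_neg hne]
        omega
      · simp only [topple, if_neg hav, if_neg hbv]
        omega

/-- The number of edges from `u` to a set of sites. -/
def degreeIn (S : SinkGraph V) (A : Finset S.Site) (u : S.Site) : ℕ := ∑ x ∈ A, S.mult u.1 x.1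

/-- No subset of `T` supports a forbidden subconfiguration. -/
def Allowed (S : SinkGraph V) (T : Finset S.Site) (c : S.Config) : Prop :=
  ∀ A ⊆ T, A.Nonempty → ∃ u ∈ A, S.degreeIn A u ≤ c u

theorem Allowed.mono {V : Type*} {S : SinkGraph V} {T : Finset S.Site} {c d : S.Config}
    (h : S.Allowed T c) (hcd : c ≤ d) : S.Allowed T d := fun A hA hne =>
  let ⟨u, hu, hle⟩ := h A hA hne
  ⟨u, hu, hle.trans (hcd u)⟩

/-- A set containing `v` is tested by removing `v`: each remaining site gains as many particles as
it has edges to `v`, exactly the increase of the requirement. Hence a configuration is allowed on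
the set of all sites that have toppled. -/
theorem Allowed.topple {S : SinkGraph V} {T : Finset S.Site} {c : S.Config} (h : S.Allowed T c)
    (v : S.Site) : S.Allowed (insert v T) (S.topple c v) := by
  intro A hA hne
  by_cases hvA : v ∈ A
  · have hsub : A.erase v ⊆ T := fun x hx =>
      (mem_insert.1 (hA (mem_of_mem_erase hx))).resolve_left (ne_of_mem_erase hx)
    rcases (A.erase v).eq_empty_or_nonempty with he | he
    · refine ⟨v, hvA, ?_⟩
      have : A = {v} := by
        rw [← insert_erase hvA, he]; rfl
      simp [this, degreeIn, S.mult_self]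
    · obtain ⟨u, hu, hle⟩ := h _ hsub he
      refine ⟨u, mem_of_mem_erase hu, ?_⟩
      have hD : S.degreeIn A u = S.degreeIn (A.erase v) u + S.mult u.1 v.1 :=
        (sum_erase_add A (fun x => S.mult u.1 x.1) hvA).symm
      simp only [SinkGraph.topple, if_neg (ne_of_mem_erase hu), hD, S.mult_comm v.1 u.1]
      omega
  · have hsub : A ⊆ T := fun x hx =>
      (mem_insert.1 (hA hx)).resolve_left (fun h => hvA (h ▸ hx))
    obtain ⟨u, hu, hle⟩ := h _ hsub hne
    refine ⟨u, hu, ?_⟩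
    have huv : u ≠ v := fun h => hvA (h ▸ hu)
    simp only [SinkGraph.topple, if_neg huv]
    omega

/-- The result of toppling every site `u` exactly `y u` times can be reached legally if it is an
allowed configuration. -/
theorem topplesTo_of_allowed {S : SinkGraph V} {c : S.Config} (hc : S.Allowed univ c) (n : ℕ)
    (y : S.Site → ℕ) (hy : ∑ u, y u = n) (c' : S.Config)
    (hc' : ∀ u, c' u + ∑ x, S.mult u.1 x.1 * y x = c u + S.degree u.1 * y u) :
    S.TopplesTo c' c := by
  induction n generalizing y c' with
  | zero =>
    have hy0 : ∀ u, y u = 0 := fun u => (sum_eq_zero_iff.1 hy) u (mem_univ u)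
    have : c' = c := by
      funext u
      simpa [hy0] using hc' u
    rw [this]
    exact Relation.ReflTransGen.refl
  | succ n ih =>
    have hne : Nonempty S.Site := by
      by_contra h
      rw [not_nonempty_iff] at h
      simp at hy
    obtain ⟨x, hx⟩ := Finite.exists_max y
    have hx0 : 0 < y x := by
      by_contra! h
      have : ∑ u, y u = 0 := sum_eq_zero fun u _ => by have := hx u; omega
      omega
    -- Among the sites with most topplings left, allowedness of the target selects one that is
    -- unstable now: all other vertices, including the sink, have at least one toppling less.
    obtain ⟨u, huA, hu⟩ := hc (univ.filter fun u => y u = y x) (subset_univ _) ⟨x, by simp⟩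
    have hyu : y u = y x := by simpa using huA
    have hbound : ∑ z, S.mult u.1 z.1 * y z + S.degree u.1 ≤
        S.degree u.1 * y u + S.degreeIn (univ.filter fun u => y u = y x) u := by
      have hpt : ∀ z : S.Site, S.mult u.1 z.1 * y z + S.mult u.1 z.1 ≤
          S.mult u.1 z.1 * y x + if y z = y x then S.mult u.1 z.1 else 0 := by
        intro z
        split_ifs with hz
        · rw [hz]
        · have hlt : y z + 1 ≤ y x := lt_of_le_of_ne (hx z) hz
          nlinarith [Nat.mul_le_mul_left (S.mult u.1 z.1) hlt]
      have hsum := sum_le_sum fun z (_ : z ∈ univ) => hpt z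
      rw [sum_add_distrib, sum_add_distrib, ← sum_mul] at hsum
      have hdeg : S.degree u.1 = ∑ z : S.Site, S.mult u.1 z.1 + S.mult u.1 S.sink := by
        rw [degree, ← sum_erase_add univ _ (mem_univ S.sink)]
        congr 1
        exact sum_subtype _ (by simp) _
      rw [degreeIn, sum_filter, hyu, hdeg, add_mul]
      have : S.mult u.1 S.sink ≤ S.mult u.1 S.sink * y x := Nat.le_mul_of_pos_right _ hx0
      omega
    have hun : S.Unstable c' u := by
      have := hc' u
      unfold Unstable
      omega
    refine Relation.ReflTransGen.head ⟨u, hun, rfl⟩ (ih (fun z => if z = u then y u - 1 else y z)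
      ?_ (S.topple c' u) ?_)
    · have h1 := sum_erase_add univ y (mem_univ u)
      have h2 := sum_erase_add univ (fun z => if z = u then y u - 1 else y z) (mem_univ u)
      rw [sum_congr rfl fun z hz => if_neg (ne_of_mem_erase hz), if_pos rfl] at h2
      change ∑ z ∈ univ.erase u, y z + (y u - 1) = _ at h2
      omega
    · intro z
      have h1 := sum_erase_add univ (fun x => S.mult z.1 x.1 * y x) (mem_univ u)
      have h2 := sum_erase_add univ
        (fun x => S.mult z.1 x.1 * if x = u then y u - 1 else y x) (mem_univ u)
      rw [sum_congr rfl fun x hx => by rw [if_neg (ne_of_mem_erase hx)], if_pos rfl] at h2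
      have h3 := hc' z
      obtain ⟨k, hk⟩ : ∃ k, y u = k + 1 := ⟨y u - 1, by omega⟩
      by_cases hzu : z = u
      · subst hzu
        simp only [SinkGraph.topple, if_true]
        rw [hk] at h1 h2 h3 ⊢
        simp only [S.mult_self, zero_mul, Nat.add_sub_cancel] at h1 h2 h3 ⊢
        have : S.degree z.1 ≤ c' z := hun
        rw [mul_add, mul_one] at h3
        omega
      · simp only [SinkGraph.topple, if_neg hzu]
        rw [hk] at h1 h2 ⊢
        simp only [Nat.add_sub_cancel, mul_add, mul_one] at h1 h2 ⊢
        rw [S.mult_comm u.1 z.1]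
        omega

/-- A configuration without forbidden subconfigurations is recurrent. -/
theorem isRecurrent_of_allowed {S : SinkGraph V} (hS : S.IsConnected) {c : S.Config}
    (hc : S.Allowed univ c) : S.IsRecurrent c := by
  intro c'
  obtain ⟨h, h0, hnn, h1⟩ := exists_green hS
  -- `N` covers both `c'` and the rounding: replacing `N * h` by its ceiling lowers the Laplacian at
  -- `u` by at most `degree u`.
  obtain ⟨N, hN⟩ : ∃ N : ℕ, ∀ u : S.Site, c' u + S.degree u.1 ≤ N :=
    ⟨∑ u : S.Site, (c' u + S.degree u.1), fun u =>
      single_le_sum (f := fun u : S.Site => c' u + S.degree u.1)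
        (fun _ _ => Nat.zero_le _) (mem_univ u)⟩
  let z : V → ℕ := fun v => ⌈(N : ℝ) * h v⌉₊
  have hz0 : z S.sink = 0 := by simp [z, h0]
  have hzle : ∀ v, (z v : ℝ) ≤ N * h v + 1 := fun v =>
    (Nat.ceil_lt_add_one (mul_nonneg (Nat.cast_nonneg _) (hnn v))).le
  have hzge : ∀ v, (N : ℝ) * h v ≤ z v := fun v => Nat.le_ceil _
  have hlap : ∀ u : S.Site, c' u + ∑ x, S.mult u.1 x * z x ≤ S.degree u.1 * z u.1 := by
    intro u
    have e1 : S.degree u.1 * h u.1 - ∑ x, (S.mult u.1 x : ℝ) * h x = 1 := h1 u.1 u.2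
    have e2 : ∑ x, (S.mult u.1 x : ℝ) * z x ≤
        N * ∑ x, (S.mult u.1 x : ℝ) * h x + S.degree u.1 := by
      rw [degree, Nat.cast_sum, mul_sum, ← sum_add_distrib]
      refine sum_le_sum fun x _ => ?_
      have := mul_le_mul_of_nonneg_left (hzle x) (Nat.cast_nonneg (α := ℝ) (S.mult u.1 x))
      linarith
    have e3 : (S.degree u.1 : ℝ) * (N * h u.1) ≤ S.degree u.1 * z u.1 :=
      mul_le_mul_of_nonneg_left (hzge _) (Nat.cast_nonneg _)
    have e4 : (c' u : ℝ) + S.degree u.1 ≤ N := by exact_mod_cast hN u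
    have e5 : (N : ℝ) * (S.degree u.1 * h u.1 - ∑ x, (S.mult u.1 x : ℝ) * h x) = N := by
      rw [e1, mul_one]
    have : (c' u : ℝ) + ∑ x, (S.mult u.1 x : ℝ) * z x ≤ S.degree u.1 * z u.1 := by linarith
    exact_mod_cast this
  have hsite : ∀ u : S.Site, ∑ x : S.Site, S.mult u.1 x.1 * z x.1 = ∑ x, S.mult u.1 x * z x :=
    fun u => S.sum_site (fun x => S.mult u.1 x * z x) (by simp [hz0])
  refine ⟨fun u => c u + S.degree u.1 * z u.1 - ∑ x, S.mult u.1 x * z x, fun u => ?_,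
    topplesTo_of_allowed hc _ (fun u => z u.1) rfl _ fun u => ?_⟩
  -- The starting configuration is `c` plus the Laplacian of `z`, which dominates `c'`; toppling
  -- each site `z` times leads back to `c`.
  · have := hlap u
    dsimp only
    omega
  · have := hlap u
    rw [hsite]
    omega

/-! ### Bounds for the transience class -/

theorem le_tcl {S : SinkGraph V} {k : ℕ} {c : S.Config} (h : S.TransientRun k c) :
    (k : ℕ∞) ≤ S.tcl :=
  le_iSup₂ (f := fun (k : ℕ) (_ : k ∈ {k : ℕ | ∃ c, S.TransientRun k c}) => (k : ℕ∞)) k ⟨c, h⟩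

theorem tcl_le {S : SinkGraph V} {N : ℕ} (h : ∀ k c, S.TransientRun k c → k ≤ N) :
    S.tcl ≤ (N : ℕ∞) :=
  iSup₂_le fun k ⟨c, hc⟩ => by exact_mod_cast h k c hc

/-- During a run, a site that has not toppled keeps all the weight of the added particles. -/
theorem TransientRun.exists_toppled {S : SinkGraph V} {k : ℕ} {c : S.Config}
    (h : S.TransientRun k c) (p : V → V → ℝ) (hp : ∀ w, w ≠ S.sink → S.IsPotential w (p w))
    {ε : ℝ} (hε : ∀ w v, w ≠ S.sink → v ≠ S.sink → ε ≤ p w v) :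
    ∃ T : Finset S.Site, S.Allowed T c ∧ ∀ w : S.Site, w ∉ T → k * ε ≤ S.weight (p w.1) c := by
  induction h with
  | empty _ =>
    refine ⟨∅, fun A hA hne => ?_, fun w _ => by simp [weight]⟩
    rw [subset_empty.1 hA] at hne
    exact absurd hne (by simp)
  | @add k c d v _ htop _ _ ih =>
    obtain ⟨T, hT, hw⟩ := ih
    suffices H : ∀ d, S.TopplesTo (c + Pi.single v 1) d → ∃ T : Finset S.Site, S.Allowed T d ∧
        ∀ w : S.Site, w ∉ T → (k + 1) * ε ≤ S.weight (p w.1) d by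
      obtain ⟨T', h1, h2⟩ := H d htop
      exact ⟨T', h1, fun w hw => by push_cast; exact h2 w hw⟩
    intro d hd
    induction hd with
    | refl =>
      refine ⟨T, hT.mono (le_add_of_nonneg_right (fun _ => Nat.zero_le _)), fun w hwT => ?_⟩
      rw [weight_add_single]
      linarith [hw w hwT, hε w.1 v.1 w.2 v.2]
    | tail _ hstep ih =>
      obtain ⟨T', h1, h2⟩ := ih
      obtain ⟨x, hx, rfl⟩ := hstep
      refine ⟨insert x T', h1.topple x, fun w hwT => ?_⟩
      rw [mem_insert, not_or] at hwT
      have hpw := isPotential_iff.1 (hp w.1 w.2)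
      rw [S.weight_topple hpw.1 hx, hpw.2.2 x.1 x.2 (fun h => hwT.1 (Subtype.ext h.symm)),
        sub_zero]
      exact h2 w hwT.2

theorem TransientRun.not_isRecurrent {S : SinkGraph V} {k : ℕ} {c : S.Config}
    (h : S.TransientRun k c) : ¬ S.IsRecurrent c := by
  cases h <;> assumption

theorem TransientRun.isStable {S : SinkGraph V} (hS : S.IsConnected) {k : ℕ} {c : S.Config}
    (h : S.TransientRun k c) : S.IsStable c := by
  cases h with
  | empty _ => exact fun v => not_le.2 (degree_pos hS v.2)
  | add => assumption

/-- The transience class is small if all potentials are large. -/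
theorem tcl_le_of_potential {S : SinkGraph V} (hS : S.IsConnected) {M : ℕ}
    (hM : ∀ w v p, w ≠ S.sink → v ≠ S.sink → S.IsPotential w p → 1 ≤ M * p v) :
    S.tcl ≤ ((M * ∑ v : S.Site, S.degree v.1 : ℕ) : ℕ∞) := by
  refine tcl_le fun k c hrun => ?_
  choose! p hp using fun w (hw : w ≠ S.sink) => exists_isPotential hS hw
  -- `M = 0` is possible only without sites, where the unique configuration is recurrent.
  by_cases hM0 : M = 0
  · exfalso
    by_cases hne : Nonempty S.Site
    · obtain ⟨w⟩ := hne
      have := hM w.1 w.1 _ w.2 w.2 (hp w.1 w.2)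
      simp only [hM0, Nat.cast_zero, zero_mul] at this
      linarith
    · refine hrun.not_isRecurrent (isRecurrent_of_allowed hS fun A _ hA => ?_)
      exact absurd ⟨hA.choose⟩ hne
  have hMpos : (0 : ℝ) < M := by positivity
  obtain ⟨T, hT, hw⟩ := hrun.exists_toppled p hp (ε := 1 / M) fun w v hw hv => by
    rw [div_le_iff₀ hMpos, mul_comm]
    exact hM w v _ hw hv (hp w hw)
  obtain ⟨w, hwT⟩ : ∃ w, w ∉ T := by
    by_contra! h
    refine hrun.not_isRecurrent (isRecurrent_of_allowed hS ?_)
    rwa [eq_univ_of_forall h] at hT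
  have h1 := hw w hwT
  have h2 : S.weight (p w.1) c ≤ ∑ v : S.Site, (S.degree v.1 : ℝ) := by
    refine sum_le_sum fun v _ => ?_
    have hlt : c v < S.degree v.1 := not_le.1 (hrun.isStable hS v)
    calc (c v : ℝ) * p w.1 v.1 ≤ c v * 1 :=
          mul_le_mul_of_nonneg_left ((hp w.1 w.2).le_one hS v.1) (Nat.cast_nonneg _)
      _ ≤ S.degree v.1 := by rw [mul_one]; exact_mod_cast hlt.le
  have h3 : (k : ℝ) ≤ M * ∑ v : S.Site, (S.degree v.1 : ℝ) := by
    have := h1.trans h2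
    rw [mul_one_div, div_le_iff₀ hMpos] at this
    linarith
  exact_mod_cast h3

theorem weight_le_of_topplesTo {S : SinkGraph V} {f : V → ℝ} (h0 : f S.sink = 0)
    (hf : ∀ v, v ≠ S.sink → 0 ≤ S.lap f v) {c d : S.Config} (h : S.TopplesTo c d) :
    S.weight f d ≤ S.weight f c := by
  induction h with
  | refl => exact le_rfl
  | tail _ hstep ih =>
    obtain ⟨v, hv, rfl⟩ := hstep
    rw [S.weight_topple h0 hv]
    linarith [hf v.1 v.2]

/-- All particles are dropped at the same site `v`: each raises the weight by `f v`, and toppling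
cannot raise it since `f` is superharmonic. -/
theorem exists_transientRun_or_isRecurrent {S : SinkGraph V} (hS : S.IsConnected) {f : V → ℝ}
    (h0 : f S.sink = 0) (hf : ∀ v, v ≠ S.sink → 0 ≤ S.lap f v) (hnn : ∀ v, 0 ≤ f v) (v : S.Site)
    (k : ℕ) : (∃ c, S.TransientRun k c ∧ S.weight f c ≤ k * f v.1) ∨
      ∃ c, S.IsRecurrent c ∧ S.weight f c ≤ k * f v.1 := by
  induction k with
  | zero =>
    by_cases h : S.IsRecurrent 0
    · exact Or.inr ⟨0, h, by simp [weight]⟩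
    · exact Or.inl ⟨0, .empty h, by simp [weight]⟩
  | succ k ih =>
    rcases ih with ⟨c, hc, hle⟩ | ⟨c, hc, hle⟩
    · obtain ⟨d, hd, hst⟩ := exists_stabilization hS (c + Pi.single v 1)
      have hw := weight_le_of_topplesTo h0 hf hd
      rw [weight_add_single] at hw
      have hle' : S.weight f d ≤ (k + 1 : ℕ) * f v.1 := by push_cast; linarith
      by_cases hrec : S.IsRecurrent d
      · exact Or.inr ⟨d, hrec, hle'⟩
      · exact Or.inl ⟨d, .add v hc hd hst hrec, hle'⟩
    · refine Or.inr ⟨c, hc, hle.trans ?_⟩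
      push_cast
      linarith [hnn v.1]

/-- All potentials are large if the transience class is small. -/
theorem one_le_mul_potential {S : SinkGraph V} (hS : S.IsConnected) (hO : S.OrdinaryConnected)
    {K D : ℕ} (hK : S.tcl ≤ (K : ℕ∞)) (hD : ∀ v, v ≠ S.sink → S.degree v ≤ D) {w v : V}
    {p : V → ℝ} (hw : w ≠ S.sink) (hv : v ≠ S.sink) (hp : S.IsPotential w p) :
    1 ≤ (D : ℝ) * (K + 1) * p v := by
  have hnn := hp.nonneg hS
  obtain ⟨h0, h1, h⟩ := isPotential_iff.1 hp
  have hD1 : (1 : ℝ) ≤ D := by exact_mod_cast (degree_pos hS hw).trans_le (hD w hw)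
  -- The case `v ≠ w` provides a second site, so that `w` has a neighbour other than the sink.
  by_cases hvw : v = w
  · rw [hvw, h1, mul_one]
    have : (0 : ℝ) ≤ K := Nat.cast_nonneg _
    nlinarith
  have hlap : ∀ x, x ≠ S.sink → 0 ≤ S.lap p x := by
    intro x hx
    by_cases hxw : x = w
    · rw [hxw, lap_eq_sum]
      refine sum_nonneg fun u _ => mul_nonneg (Nat.cast_nonneg _) ?_
      rw [h1, sub_nonneg]
      exact hp.le_one hS u
    · exact (h x hx hxw).ge
  obtain ⟨c, hc, hle⟩ : ∃ c, S.IsRecurrent c ∧ S.weight p c ≤ (K + 1 : ℕ) * p v := by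
    rcases exists_transientRun_or_isRecurrent hS h0 hlap hnn ⟨v, hv⟩ (K + 1) with
      ⟨c, hc, _⟩ | h
    · have := (le_tcl hc).trans hK
      have : K + 1 ≤ K := by exact_mod_cast this
      omega
    · exact h
  have : Nontrivial {x : V | x ≠ S.sink} :=
    ⟨⟨⟨v, hv⟩, ⟨w, hw⟩, fun h => hvw (congrArg Subtype.val h)⟩⟩
  obtain ⟨x, hx⟩ := hO.preconnected.exists_adj_of_nontrivial ⟨w, hw⟩
  have hwx : 0 < S.mult w x.1 := hx
  have hxs : x.1 ≠ S.sink := x.2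
  push_cast at hle
  suffices H : 1 ≤ (D : ℝ) * S.weight p c by
    calc (1 : ℝ) ≤ D * S.weight p c := H
      _ ≤ D * ((K + 1) * p v) := by gcongr
      _ = D * (K + 1) * p v := by ring
  have hW := S.weight_nonneg hnn c
  rcases hc.pos_or_pos (a := ⟨w, hw⟩) (b := ⟨x.1, hxs⟩) hwx with hpos | hpos
  · have := S.mul_le_weight hnn c ⟨w, hw⟩
    have hc1 : (1 : ℝ) ≤ c ⟨w, hw⟩ := by exact_mod_cast hpos
    simp only [h1, mul_one] at this
    nlinarith
  · have := S.mul_le_weight hnn c ⟨x.1, hxs⟩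
    have hc1 : (1 : ℝ) ≤ c ⟨x.1, hxs⟩ := by exact_mod_cast hpos
    have hxw : x.1 ≠ w := by
      intro e
      rw [e, S.mult_self] at hwx
      exact lt_irrefl _ hwx
    have hstep := hp.mul_le_degree_mul hS hxs hxw (by rw [S.mult_comm]; exact hwx)
    rw [h1] at hstep
    have hDx : (S.degree x.1 : ℝ) ≤ D := by exact_mod_cast hD x.1 hxs
    calc (1 : ℝ) ≤ S.degree x.1 * p x.1 := hstep
      _ ≤ D * p x.1 := mul_le_mul_of_nonneg_right hDx (hnn _)
      _ ≤ D * S.weight p c := by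
        refine mul_le_mul_of_nonneg_left (le_trans ?_ this) (Nat.cast_nonneg _)
        exact le_mul_of_one_le_left (hnn _) hc1

/-- The number of sites is at most the transience class plus two if all degrees are at least
two. -/
theorem card_site_le {S : SinkGraph V} (hO : S.OrdinaryConnected)
    (hdeg : ∀ v : S.Site, 2 ≤ S.degree v.1) {K : ℕ} (hK : S.tcl ≤ (K : ℕ∞)) : Fintype.card S.Site ≤ K + 2 := by
  rcases subsingleton_or_nontrivial S.Site with hsub | hnt
  · have := Fintype.card_le_one_iff_subsingleton.2 hsub
    omega
  obtain ⟨a⟩ := hnt.to_nonempty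
  have : Nontrivial {x : V | x ≠ S.sink} := hnt
  obtain ⟨b, hb⟩ := hO.preconnected.exists_adj_of_nontrivial ⟨a.1, a.2⟩
  have hab : 0 < S.mult a.1 b.1 := hb
  let b' : S.Site := ⟨b.1, b.2⟩
  -- One particle per site is stable because degrees are at least two, and the empty adjacent pair
  -- `a`, `b'` prevents recurrence.
  have hrun : ∀ A : Finset S.Site, a ∉ A → b' ∉ A →
      S.TransientRun A.card (fun v => if v ∈ A then 1 else 0) := by
    intro A
    induction A using Finset.induction_on with
    | empty =>
      intro _ _
      refine .empty fun h => ?_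
      simpa using h.pos_or_pos (a := a) (b := b') hab
    | insert x A hxA ih =>
      intro ha hb
      rw [mem_insert, not_or] at ha hb
      rw [card_insert_of_notMem hxA]
      refine .add x (ih ha.2 hb.2) (d := fun v => if v ∈ insert x A then 1 else 0) ?_ ?_ ?_
      · have : ((fun v => if v ∈ A then 1 else 0) + Pi.single x 1 : S.Config) =
            fun v => if v ∈ insert x A then 1 else 0 := by
          funext v
          by_cases hvx : v = x
          · simp [hvx, hxA]
          · simp [hvx]
        rw [this]
        exact Relation.ReflTransGen.refl
      · intro v hv
        have h2 := (hdeg v).trans hv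
        dsimp only at h2
        split_ifs at h2 <;> omega
      · intro h
        simpa [ha.1, ha.2, hb.1, hb.2] using h.pos_or_pos (a := a) (b := b') hab
  have h := (le_tcl (hrun ((univ.erase a).erase b') (by simp) (by simp))).trans hK
  have h' : ((univ.erase a).erase b').card ≤ K := by exact_mod_cast h
  have h1 := pred_card_le_card_erase (s := univ.erase a) (a := b')
  have h2 := pred_card_le_card_erase (s := univ) (a := a)
  rw [card_univ] at h2
  omega

end Dynamics

end SinkGraph

namespace SinkGraph

open Finset

/-! ### Changing the conductances to the sink -/

/-- The tangent line inequality for powers. -/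
theorem tangent_le_pow {a x : ℝ} (ha : 0 ≤ a) (hx : 0 ≤ x) (K : ℕ) :
    a ^ (K + 1) + (K + 1) * a ^ K * (x - a) ≤ x ^ (K + 1) := by
  induction K with
  | zero => simp
  | succ K ih =>
    have h1 := mul_le_mul_of_nonneg_left ih hx
    have h2 : 0 ≤ ((K : ℝ) + 1) * a ^ K * (x - a) ^ 2 := by positivity
    push_cast
    rw [pow_succ x (K + 1)]
    have e : a ^ (K + 1 + 1) + ((K : ℝ) + 1 + 1) * a ^ (K + 1) * (x - a) +
        ((K : ℝ) + 1) * a ^ K * (x - a) ^ 2 =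
        x * (a ^ (K + 1) + ((K : ℝ) + 1) * a ^ K * (x - a)) := by ring
    linarith

section Comparison

variable {V : Type*} [Fintype V] {S T : SinkGraph V}

theorem lap_eq_lap_add (hsink : T.sink = S.sink)
    (hm : ∀ u v, u ≠ S.sink → v ≠ S.sink → T.mult u v = S.mult u v) (f : V → ℝ)
    (hf : f S.sink = 0) {v : V} (hv : v ≠ S.sink) :
    T.lap f v = S.lap f v + ((T.mult v T.sink : ℝ) - S.mult v S.sink) * f v := by
  classical
  rw [lap_eq_sum, lap_eq_sum, ← sum_erase_add _ _ (mem_univ S.sink),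
    ← sum_erase_add (a := S.sink) _ (fun u => (S.mult v u : ℝ) * (f v - f u)) (mem_univ S.sink),
    sum_congr rfl fun u hu => by rw [hm v u hv (ne_of_mem_erase hu)], hf, hsink]
  ring

/-- Raising the conductances to the sink lowers the potentials. -/
theorem IsPotential.le_of_sink_mult_le (hS : S.IsConnected) (hsink : T.sink = S.sink)
    (hT : T.IsConnected)
    (hm : ∀ u v, u ≠ S.sink → v ≠ S.sink → T.mult u v = S.mult u v)
    (hle : ∀ v, S.mult v S.sink ≤ T.mult v T.sink) {w : V} {p q : V → ℝ}
    (hp : S.IsPotential w p) (hq : T.IsPotential w q) (v : V) : q v ≤ p v := by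
  obtain ⟨h0, h1, h⟩ := isPotential_iff.1 hq
  refine hp.ge_of_subharmonic hS (hsink ▸ h0).le h1.le (fun x hx hxw => ?_) v
  have e := lap_eq_lap_add hsink hm q (hsink ▸ h0) hx
  rw [h x (hsink ▸ hx) hxw] at e
  -- The Laplacian of `q` in `S` is minus this product, so `q` is subharmonic for `S`.
  have hmul : 0 ≤ ((T.mult x T.sink : ℝ) - S.mult x S.sink) * q x :=
    mul_nonneg (sub_nonneg.2 (by exact_mod_cast hle x)) (hq.nonneg hT x)
  linarith

/-- Raising the conductances to the sink at most `K`-fold raises the potentials at most to the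
`K`-th power. -/
theorem IsPotential.pow_le_of_sink_mult_le (hS : S.IsConnected) (hsink : T.sink = S.sink)
    (hT : T.IsConnected)
    (hm : ∀ u v, u ≠ S.sink → v ≠ S.sink → T.mult u v = S.mult u v) {K : ℕ} (hK : 1 ≤ K)
    (hle : ∀ v, T.mult v T.sink ≤ K * S.mult v S.sink) {w : V} {p q : V → ℝ}
    (hp : S.IsPotential w p) (hq : T.IsPotential w q) (v : V) : p v ^ K ≤ q v := by
  obtain ⟨h0, h1, h⟩ := isPotential_iff.1 hp
  obtain ⟨k, rfl⟩ : ∃ k, K = k + 1 := ⟨K - 1, by omega⟩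
  refine hq.ge_of_subharmonic (f := fun x => p x ^ (k + 1)) hT (by simp [hsink, h0]) (by simp [h1])
    (fun x hx hxw => ?_) v
  rw [lap_eq_lap_add hsink hm _ (by simp [h0]) (hsink ▸ hx)]
  have hlap := h x (hsink ▸ hx) hxw
  rw [lap_eq_sum] at hlap ⊢
  classical
  set a := p x with ha
  have ha0 : 0 ≤ a := hp.nonneg hS x
  rw [← sum_erase_add _ _ (mem_univ S.sink), h0] at hlap
  rw [← sum_erase_add _ _ (mem_univ S.sink)]
  simp only [h0, zero_pow (Nat.succ_ne_zero k), sub_zero]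
  -- By convexity, the inner flow for `p ^ (k + 1)` is at most `(k + 1) * a ^ k` times that for `p`,
  -- which harmonicity makes negative; the factor `k + 1` pays for the enlarged conductance.
  have hsum : ∑ u ∈ univ.erase S.sink, (S.mult x u : ℝ) * (a ^ (k + 1) - p u ^ (k + 1)) ≤
      (k + 1) * a ^ k * ∑ u ∈ univ.erase S.sink, (S.mult x u : ℝ) * (a - p u) := by
    rw [mul_sum]
    refine sum_le_sum fun u _ => ?_
    have ht := tangent_le_pow ha0 (hp.nonneg hS u) k
    have := mul_le_mul_of_nonneg_left ht (Nat.cast_nonneg (α := ℝ) (S.mult x u))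
    linarith
  have hsub : ∑ u ∈ univ.erase S.sink, (S.mult x u : ℝ) * (a - p u) = -(S.mult x S.sink * a) := by
    linarith
  rw [hsub] at hsum
  have hle' : (T.mult x T.sink : ℝ) ≤ (k + 1) * S.mult x S.sink := by exact_mod_cast hle x
  have hmul := mul_le_mul_of_nonneg_right hle' (pow_nonneg ha0 (k + 1))
  have e : (k + 1 : ℝ) * a ^ k * -(S.mult x S.sink * a) =
      -((k + 1) * S.mult x S.sink * a ^ (k + 1)) := by ring
  linarith

end Comparison

/-! ### Families of polynomial transience class -/

section Family

variable {V W : ℕ → Type*} [∀ n, Fintype (V n)] [∀ n, DecidableEq (V n)]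
  [∀ n, Fintype (W n)] [∀ n, DecidableEq (W n)]

/-- If the transience class of `T n` is bounded by a fixed polynomial in the transience class of
`S n` and a polynomially growing parameter, then polynomial growth carries over from `S` to `T`. -/
theorem InTCLPoly.of_bound {S : ∀ n, SinkGraph (V n)} {T : ∀ n, SinkGraph (W n)} (g : ℕ → ℕ)
    (hg : ∃ k C : ℕ, ∀ᶠ n in Filter.atTop, g n ≤ C * n ^ k) (A m : ℕ)
    (h : ∀ n K : ℕ, (S n).tcl ≤ (K : ℕ∞) → g n ≤ K →
      (T n).tcl ≤ ((A * (K + 1) ^ m : ℕ) : ℕ∞))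
    (hS : InTCLPoly S) : InTCLPoly T := by
  obtain ⟨k, C, hC⟩ := hS
  obtain ⟨k', C', hC'⟩ := hg
  refine ⟨(k + k') * m, A * (C + C' + 1) ^ m, ?_⟩
  filter_upwards [hC, hC', Filter.eventually_ge_atTop 1] with n h1 h2 hn
  have hpow : ∀ j, 1 ≤ n ^ j := fun j => Nat.one_le_pow _ _ hn
  have e1 : C * n ^ k ≤ C * n ^ (k + k') :=
    Nat.mul_le_mul_left _ (Nat.pow_le_pow_right hn (by omega))
  have e2 : C' * n ^ k' ≤ C' * n ^ (k + k') :=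
    Nat.mul_le_mul_left _ (Nat.pow_le_pow_right hn (by omega))
  have e3 := hpow (k + k')
  refine (h n ((C + C') * n ^ (k + k')) (h1.trans ?_) (by rw [add_mul]; omega)).trans ?_
  · have : C * n ^ k ≤ (C + C') * n ^ (k + k') := by rw [add_mul]; omega
    exact_mod_cast this
  · have : A * ((C + C') * n ^ (k + k') + 1) ^ m ≤
        A * (C + C' + 1) ^ m * n ^ ((k + k') * m) := by
      rw [pow_mul, mul_assoc, ← mul_pow]
      gcongr
      rw [add_mul (C + C'), one_mul]
      omega
    exact_mod_cast this

end Family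

/-! ### Network equivalence -/

section NetworkEquiv

variable {V W : Type*} [Fintype V] [Fintype W]

theorem NetworkEquiv.symm {S : SinkGraph V} {T : SinkGraph W} (h : S.NetworkEquiv T) :
    T.NetworkEquiv S := by
  obtain ⟨e, he⟩ := h
  refine ⟨e.symm, fun v => ?_⟩
  obtain ⟨p, q, hp, hq, hpq⟩ := he (e.symm v)
  rw [e.apply_symm_apply] at hq
  refine ⟨q, p, hq, hp, fun w => ?_⟩
  rw [hpq, e.apply_symm_apply]

/-- The summand 1 absorbs the truncated division in `numEdges`, so the parity of the degree sum is
not needed. -/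
theorem sum_degree_le (S : SinkGraph V) : ∑ v, S.degree v ≤ 2 * S.numEdges + 1 := by
  unfold numEdges
  omega

theorem degree_le (S : SinkGraph V) (v : V) : S.degree v ≤ 2 * S.numEdges + 1 :=
  (single_le_sum (f := S.degree) (fun _ _ => Nat.zero_le _) (mem_univ v)).trans S.sum_degree_le

theorem card_le {S : SinkGraph V} (hS : S.IsConnected) (hO : S.OrdinaryConnected) :
    Fintype.card V ≤ 2 * S.numEdges + 1 := by
  obtain ⟨⟨x, hx⟩⟩ := hO.nonempty
  have : Nontrivial V := ⟨⟨x, S.sink, hx⟩⟩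
  refine le_trans ?_ S.sum_degree_le
  rw [← card_univ, card_eq_sum_ones]
  refine sum_le_sum fun v _ => ?_
  obtain ⟨u, hu⟩ := hS.preconnected.exists_adj_of_nontrivial v
  exact (show 0 < S.mult v u from hu).trans_le
    (single_le_sum (f := fun u => S.mult v u) (fun _ _ => Nat.zero_le _) (mem_univ u))

theorem ne_sink_of_boundary {V : Type*} {S : SinkGraph V} {v : V} (h : 0 < S.mult v S.sink) :
    v ≠ S.sink := by
  rintro rfl
  rw [S.mult_self] at h
  exact lt_irrefl _ h

variable [DecidableEq V] [DecidableEq W]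

/-- The transience class is controlled by that of a network equivalent sandpile. -/
theorem NetworkEquiv.tcl_le {S : SinkGraph V} {T : SinkGraph W} (h : S.NetworkEquiv T)
    (hS : S.IsConnected) (hSO : S.OrdinaryConnected) (hT : T.IsConnected)
    (hTO : T.OrdinaryConnected) {K : ℕ} (hK : S.tcl ≤ (K : ℕ∞)) (hSK : S.numEdges ≤ K)
    (hTK : T.numEdges ≤ K) : T.tcl ≤ ((32 * (K + 1) ^ 6 : ℕ) : ℕ∞) := by
  obtain ⟨e, he⟩ := h.symm
  have hK0 : (0 : ℝ) ≤ K := Nat.cast_nonneg K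
  set D : ℝ := 2 * K + 1 with hD
  have hDpos : 1 ≤ D := by linarith
  set ε : ℝ := 1 / (D * (K + 1)) with hε
  have hεpos : 0 < ε := by positivity
  have hε1 : ε ≤ 1 := by
    rw [hε, div_le_one (by positivity)]
    nlinarith
  have hdegS : ∀ v, v ≠ S.sink → S.degree v ≤ 2 * K + 1 := fun v _ =>
    (S.degree_le v).trans (by omega)
  have hb : ∀ b, 0 < T.mult b T.sink → ∃ p, T.IsPotential b p ∧
      ∀ b', 0 < T.mult b' T.sink → ε ≤ p b' := by
    intro b hb
    obtain ⟨p, q, hp, hq, hpq⟩ := he ⟨b, hb⟩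
    refine ⟨p, hp, fun b' hb' => ?_⟩
    have := one_le_mul_potential hS hSO hK hdegS (ne_sink_of_boundary (e ⟨b, hb⟩).2)
      (ne_sink_of_boundary (e ⟨b', hb'⟩).2) hq
    rw [← hpq] at this
    rw [hε, div_le_iff₀ (by positivity), mul_comm]
    push_cast at this
    exact this
  -- `M` is `D ^ 3 / ε`.
  have key := tcl_le_of_potential hT (M := (2 * K + 1) ^ 4 * (K + 1)) fun w v p hw hv hp => by
    have := potential_ge_of_boundary hT hεpos.le hε1 hDpos
      (by rw [hD]; exact_mod_cast (card_le hT hTO).trans (by omega))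
      (fun v => by rw [hD]; exact_mod_cast (T.degree_le v).trans (by omega)) hb hw hv hp
    rw [hε, div_le_iff₀ (by positivity)] at this
    push_cast
    rw [← hD]
    linarith
  refine key.trans ?_
  have hsum : ∑ v : T.Site, T.degree v.1 ≤ 2 * K + 1 := by
    have h1 : ∑ v : T.Site, T.degree v.1 ≤ ∑ v, T.degree v := by
      rw [← sum_subtype (univ.filter (· ≠ T.sink)) (by simp) T.degree]
      exact sum_le_sum_of_subset (subset_univ _)
    exact h1.trans (T.sum_degree_le.trans (by omega))
  have : (2 * K + 1) ^ 4 * (K + 1) * ∑ v : T.Site, T.degree v.1 ≤ 32 * (K + 1) ^ 6 := by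
    calc (2 * K + 1) ^ 4 * (K + 1) * ∑ v : T.Site, T.degree v.1
        ≤ (2 * K + 2) ^ 4 * (K + 1) * (2 * K + 2) := by
          gcongr <;> omega
      _ = 32 * (K + 1) ^ 6 := by ring
  exact_mod_cast this

end NetworkEquiv

/-- Network equivalence preserves polynomial transience class for families of polynomial size. -/
theorem InTCLPoly.of_networkEquiv {V W : ℕ → Type*} [∀ n, Fintype (V n)] [∀ n, DecidableEq (V n)]
    [∀ n, Fintype (W n)] [∀ n, DecidableEq (W n)]
    {A : ∀ n, SinkGraph (V n)} {B : ∀ n, SinkGraph (W n)}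
    (hA : ∀ n, (A n).IsConnected) (hB : ∀ n, (B n).IsConnected)
    (hAO : ∀ n, (A n).OrdinaryConnected) (hBO : ∀ n, (B n).OrdinaryConnected)
    (hAP : PolySize A) (hBP : PolySize B) (h : ∀ n, (A n).NetworkEquiv (B n))
    (hT : InTCLPoly A) : InTCLPoly B := by
  refine hT.of_bound (fun n => (A n).numEdges + (B n).numEdges) ?_ 32 6 fun n K hK hg =>
    (h n).tcl_le (hA n) (hAO n) (hB n) (hBO n) hK (by omega) (by omega)
  obtain ⟨k, C, hC⟩ := hAP
  obtain ⟨k', C', hC'⟩ := hBP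
  refine ⟨k + k', C + C', ?_⟩
  filter_upwards [hC, hC', Filter.eventually_ge_atTop 1] with n h1 h2 hn
  have e1 : C * n ^ k ≤ C * n ^ (k + k') :=
    Nat.mul_le_mul_left _ (Nat.pow_le_pow_right hn (by omega))
  have e2 : C' * n ^ k' ≤ C' * n ^ (k + k') :=
    Nat.mul_le_mul_left _ (Nat.pow_le_pow_right hn (by omega))
  rw [add_mul]
  omega

end SinkGraph

section Lattice

open Finset

/-! ### Combinatorics of the honeycomb lattice -/

theorem card_starLeaves (q : ℤ × ℤ) : (starLeaves q).card = 3 := by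
  rw [starLeaves, card_eq_three]
  exact ⟨_, _, _, by simp, by simp, by simp, rfl⟩

theorem card_starCentres (p : ℤ × ℤ) : (starCentres p).card = 3 := by
  rw [starCentres, card_eq_three]
  exact ⟨_, _, _, by simp [eq_sub_iff_add_eq], by simp [eq_sub_iff_add_eq], by simp, rfl⟩

theorem card_honeycombNbrs (x : HoneycombSite) : (honeycombNbrs x).card = 3 := by
  rcases x with p | q
  · simp [honeycombNbrs, card_starCentres]
  · simp [honeycombNbrs, card_starLeaves]

/-- Two distinct points are leaves of at most one common star. -/
theorem eq_of_mem_starLeaves {p p' q q' : ℤ × ℤ} (hne : p ≠ p') (h1 : p ∈ starLeaves q)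
    (h2 : p' ∈ starLeaves q) (h3 : p ∈ starLeaves q') (h4 : p' ∈ starLeaves q') : q = q' := by
  obtain ⟨a, b⟩ := p
  obtain ⟨a', b'⟩ := p'
  obtain ⟨c, d⟩ := q
  obtain ⟨c', d'⟩ := q'
  simp only [starLeaves, mem_insert, mem_singleton, Prod.mk.injEq, Prod.mk_add_mk, ne_eq] at *
  omega

/-- Neighbours in the triangular lattice are distinct leaves of a common star. -/
theorem mem_triangularNbrs_iff (p p' : ℤ × ℤ) :
    p' ∈ triangularNbrs p ↔ p' ≠ p ∧ ∃ q ∈ starCentres p, p' ∈ starLeaves q := by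
  obtain ⟨a, b⟩ := p
  obtain ⟨a', b'⟩ := p'
  simp only [triangularNbrs, starLeaves, starCentres, mem_insert, mem_singleton, Prod.mk.injEq,
    Prod.mk_add_mk, Prod.mk_sub_mk, ne_eq, exists_eq_or_imp, exists_eq_left]
  omega

theorem triangularNbrs_eq_biUnion (p : ℤ × ℤ) :
    triangularNbrs p = (starCentres p).biUnion fun q => (starLeaves q).erase p := by
  ext p'
  simp only [mem_triangularNbrs_iff, mem_biUnion, mem_erase]
  tauto

/-! ### Connectivity -/

namespace SinkGraph

theorem isConnected_of_ordinaryConnected {V : Type*} {S : SinkGraph V} (hO : S.OrdinaryConnected)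
    {b : V} (hb : 0 < S.mult b S.sink) : S.IsConnected := by
  have hbs := ne_sink_of_boundary hb
  have hreach : ∀ v, S.adjGraph.Reachable v S.sink := by
    intro v
    by_cases hv : v = S.sink
    · rw [hv]
    · have h1 : S.adjGraph.Reachable v b :=
        (hO.preconnected ⟨v, hv⟩ ⟨b, hbs⟩).map (SimpleGraph.Embedding.induce _).toHom
      exact h1.trans (SimpleGraph.Adj.reachable hb)
  have : Nonempty V := ⟨b⟩
  exact SimpleGraph.Connected.mk fun u v => (hreach u).trans (hreach v).symm

theorem card_site {V : Type*} [Fintype V] [DecidableEq V] (S : SinkGraph V) :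
    Fintype.card S.Site = Fintype.card V - 1 :=
  Set.card_ne_eq S.sink

/-- A sandpile without sites or with a single site has bounded transience class. -/
theorem tcl_le_of_subsingleton {V : Type*} [Fintype V] [DecidableEq V] {S : SinkGraph V}
    (hS : S.IsConnected) (h : ∀ u v, u ≠ S.sink → v ≠ S.sink → u = v) :
    S.tcl ≤ ((∑ v : S.Site, S.degree v.1 : ℕ) : ℕ∞) := by
  have := tcl_le_of_potential hS (M := 1) fun w v p hw hv hp => by
    rw [h v w hv hw, hp.2.1]
    simp
  rwa [one_mul] at this

end SinkGraph

open SinkGraph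

section Section

variable {F : Finset HoneycombSite}

theorem honeycombSandpile_ordinaryConnected
    (hF : (honeycomb.induce (F : Set HoneycombSite)).Connected) :
    (honeycombSandpile F).OrdinaryConnected := by
  let f : honeycomb.induce (F : Set HoneycombSite) →g
      (honeycombSandpile F).adjGraph.induce {v | v ≠ (honeycombSandpile F).sink} :=
    { toFun := fun x => ⟨some ⟨x.1, x.2⟩, Option.some_ne_none _⟩
      map_rel' := fun {x y} (hxy : y.1 ∈ honeycombNbrs x.1) => by
        change 0 < if y.1 ∈ honeycombNbrs x.1 then 1 else 0
        rw [if_pos hxy]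
        exact one_pos }
  refine SimpleGraph.Connected.map f ?_ hF
  rintro ⟨v, hv⟩
  obtain _ | x := v
  · exact absurd rfl hv
  · exact ⟨⟨x.1, x.2⟩, rfl⟩

/-- A point of maximal first coordinate. As `p` and `p + (1, 0)` are leaves of one star, an edge to
the sink is found there whether or not its centre lies in `F`. -/
theorem exists_mem_toLeft_add_notMem (h : F.toLeft.Nonempty) :
    ∃ p ∈ F.toLeft, p + (1, 0) ∉ F.toLeft := by
  obtain ⟨p, hp, hmax⟩ := exists_max_image F.toLeft (fun p => p.1) h
  refine ⟨p, hp, fun hp' => ?_⟩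
  have := hmax _ hp'
  simp at this

theorem honeycombSandpile_mult_sink_pos {x y : HoneycombSite} (hx : x ∈ F)
    (hy : y ∈ honeycombNbrs x) (hyF : y ∉ F) :
    0 < (honeycombSandpile F).mult (some ⟨x, hx⟩) (honeycombSandpile F).sink :=
  card_pos.2 ⟨y, mem_filter.2 ⟨hy, hyF⟩⟩

theorem honeycombSandpile_isConnected
    (hF : (honeycomb.induce (F : Set HoneycombSite)).Connected) :
    (honeycombSandpile F).IsConnected := by
  have hO := honeycombSandpile_ordinaryConnected hF
  suffices h : ∃ x ∈ F, ∃ y ∈ honeycombNbrs x, y ∉ F by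
    obtain ⟨x, hx, y, hy, hyF⟩ := h
    exact isConnected_of_ordinaryConnected hO (honeycombSandpile_mult_sink_pos hx hy hyF)
  rcases F.toLeft.eq_empty_or_nonempty with he | hne
  · obtain ⟨⟨x, hx⟩⟩ := hF.nonempty
    have hl : ∀ p, Sum.inl p ∉ F := fun p hp => by
      have := mem_toLeft.2 hp
      rw [he] at this
      exact notMem_empty _ this
    rcases x with p | q
    · exact absurd hx (hl p)
    · exact ⟨_, hx, Sum.inl q, by simp [honeycombNbrs, starLeaves], hl q⟩
  · obtain ⟨p, hp, hp'⟩ := exists_mem_toLeft_add_notMem hne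
    rw [mem_toLeft] at hp hp'
    by_cases hq : Sum.inr p ∈ F
    · exact ⟨_, hq, _, by simp [honeycombNbrs, starLeaves], hp'⟩
    · exact ⟨_, hp, _, by simp [honeycombNbrs, starCentres], hq⟩

theorem starDeltaSandpile_mult_pos {r : ℕ} {u v : F.toLeft} (hne : u ≠ v) {q : ℤ × ℤ}
    (hq : q ∈ F.toRight) (hu : u.1 ∈ starLeaves q) (hv : v.1 ∈ starLeaves q) :
    0 < (starDeltaSandpile r F).mult (some u) (some v) := by
  change 0 < if u = v then 0 else _
  rw [if_neg hne]
  exact card_pos.2 ⟨q, mem_filter.2 ⟨hq, hu, hv⟩⟩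

/-- The leaf `v` is the vertex `x` or belongs to the star with centre `x`. -/
def IsLeafAt (v : ℤ × ℤ) : HoneycombSite → Prop
  | .inl p => v = p
  | .inr q => v ∈ starLeaves q

theorem starDeltaSandpile_ordinaryConnected (r : ℕ)
    (hF : (honeycomb.induce (F : Set HoneycombSite)).Connected) (hne : F.toLeft.Nonempty) :
    (starDeltaSandpile r F).OrdinaryConnected := by
  set G := (starDeltaSandpile r F).adjGraph.induce {v | v ≠ (starDeltaSandpile r F).sink} with hG
  let site : F.toLeft → {v | v ≠ (starDeltaSandpile r F).sink} :=
    fun v => ⟨some v, Option.some_ne_none _⟩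
  have hstar : ∀ (u v : F.toLeft) (q : ℤ × ℤ), q ∈ F.toRight → u.1 ∈ starLeaves q →
      v.1 ∈ starLeaves q → G.Reachable (site u) (site v) := by
    intro u v q hq hu hv
    by_cases huv : u = v
    · rw [huv]
    · exact SimpleGraph.Adj.reachable (starDeltaSandpile_mult_pos (r := r) huv hq hu hv)
  -- Honeycomb walks pass through centres, which are no longer vertices; the induction therefore
  -- treats all leaves attached to the endpoints.
  have hwalk : ∀ (x y : {x // x ∈ (F : Set HoneycombSite)})
      (_ : (honeycomb.induce (F : Set HoneycombSite)).Walk x y) (u v : F.toLeft),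
      IsLeafAt u.1 x.1 → IsLeafAt v.1 y.1 → G.Reachable (site u) (site v) := by
    intro x y W
    induction W with
    | @nil x =>
      intro u v hu hv
      obtain ⟨p | q, hx⟩ := x
      · have : u = v := Subtype.ext (Eq.trans hu (Eq.symm hv))
        rw [this]
      · exact hstar u v q (mem_toRight.2 hx) hu hv
    | @cons x x' y hadj W ih =>
      intro u v hu hv
      obtain ⟨p | q, hx⟩ := x
      · obtain ⟨p' | q', hx'⟩ := x'
        · exact absurd (show Sum.inl p' ∈ honeycombNbrs (Sum.inl p) from hadj)
            (by simp [honeycombNbrs])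
        · have hq : Sum.inr q' ∈ honeycombNbrs (Sum.inl p) := hadj
          refine ih u v ?_ hv
          have hup : u.1 = p := hu
          simpa [honeycombNbrs, mem_starCentres_iff, IsLeafAt, hup] using hq
      · obtain ⟨p' | q', hx'⟩ := x'
        · have hp : Sum.inl p' ∈ honeycombNbrs (Sum.inr q) := hadj
          have hx'' : p' ∈ F.toLeft := mem_toLeft.2 hx'
          refine (hstar u ⟨p', hx''⟩ q (mem_toRight.2 hx) hu ?_).trans (ih ⟨p', hx''⟩ v rfl hv)
          simpa [honeycombNbrs] using hp
        · exact absurd (show Sum.inr q' ∈ honeycombNbrs (Sum.inr q) from hadj)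
            (by simp [honeycombNbrs])
  obtain ⟨p, hp⟩ := hne
  have : Nonempty {v | v ≠ (starDeltaSandpile r F).sink} := ⟨site ⟨p, hp⟩⟩
  refine SimpleGraph.Connected.mk ?_
  rintro ⟨a, ha⟩ ⟨b, hb⟩
  obtain _ | u := a
  · exact absurd rfl ha
  obtain _ | v := b
  · exact absurd rfl hb
  obtain ⟨W⟩ := hF.preconnected ⟨Sum.inl u.1, mem_toLeft.1 u.2⟩ ⟨Sum.inl v.1, mem_toLeft.1 v.2⟩
  exact hwalk _ _ W u v rfl rfl

theorem starDeltaSandpile_isConnected {r : ℕ} (hr : 1 ≤ r)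
    (hF : (honeycomb.induce (F : Set HoneycombSite)).Connected) (hne : F.toLeft.Nonempty) :
    (starDeltaSandpile r F).IsConnected := by
  obtain ⟨p, hp, hp'⟩ := exists_mem_toLeft_add_notMem hne
  refine isConnected_of_ordinaryConnected (starDeltaSandpile_ordinaryConnected r hF hne)
    (b := some ⟨p, hp⟩) ?_
  change 0 < ∑ q ∈ starCentres p,
    if q ∈ F.toRight then ((starLeaves q).filter (· ∉ F.toLeft)).card else r
  refine sum_pos' (fun _ _ => Nat.zero_le _) ⟨p, by simp [starCentres], ?_⟩
  split_ifs
  · exact card_pos.2 ⟨_, mem_filter.2 ⟨by simp [starLeaves], hp'⟩⟩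
  · exact hr

/-! ### The Laplacians of the lattice sandpiles -/

/-- A sum over the neighbours in the honeycomb sandpile, as a sum over the lattice. -/
theorem honeycombSandpile_sum_mult {R : Type*} [CommSemiring R] (x : F) (φ : Option F → R)
    (Φ : HoneycombSite → R) (hin : ∀ y : F, φ (some y) = Φ y.1)
    (hout : ∀ y, y ∉ F → Φ y = φ none) :
    ∑ y, ((honeycombSandpile F).mult (some x) y : R) * φ y = ∑ y ∈ honeycombNbrs x.1, Φ y := by
  rw [Fintype.sum_option]
  change (((honeycombNbrs x.1).filter (· ∉ F)).card : R) * φ none +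
    ∑ y : F, ((if y.1 ∈ honeycombNbrs x.1 then 1 else 0 : ℕ) : R) * φ (some y) = _
  simp only [hin]
  rw [sum_coe_sort F (fun y => ((if y ∈ honeycombNbrs x.1 then 1 else 0 : ℕ) : R) * Φ y)]
  rw [← sum_filter_not_add_sum_filter (honeycombNbrs x.1) (· ∈ F) Φ]
  congr 1
  · rw [sum_congr rfl fun y hy => hout y (mem_filter.1 hy).2, sum_const, nsmul_eq_mul]
  · simp only [Nat.cast_ite, Nat.cast_one, Nat.cast_zero, ite_mul, one_mul, zero_mul]
    rw [← sum_filter]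
    exact sum_congr (by ext y; simp [and_comm]) fun _ _ => rfl

/-- A sum over the neighbours in the star-delta sandpile, as a sum over the stars. -/
theorem starDeltaSandpile_sum_mult {R : Type*} [CommSemiring R] (r : ℕ) (v : F.toLeft)
    (φ : Option F.toLeft → R) (Φ : ℤ × ℤ → R) (hin : ∀ u : F.toLeft, φ (some u) = Φ u.1)
    (hout : ∀ u, u ∉ F.toLeft → Φ u = φ none) (hv : Φ v.1 = 0) :
    ∑ u, ((starDeltaSandpile r F).mult (some v) u : R) * φ u =
      ∑ q ∈ starCentres v.1, if q ∈ F.toRight then ∑ u ∈ starLeaves q, Φ u else r * φ none := by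
  rw [Fintype.sum_option]
  change ((∑ q ∈ starCentres v.1,
      if q ∈ F.toRight then ((starLeaves q).filter (· ∉ F.toLeft)).card else r : ℕ) : R) * φ none +
    ∑ u : F.toLeft, ((if v = u then 0 else (F.toRight.filter
      (fun q => v.1 ∈ starLeaves q ∧ u.1 ∈ starLeaves q)).card : ℕ) : R) * φ (some u) = _
  have hterm : ∀ u : F.toLeft, ((if v = u then 0 else (F.toRight.filter
      (fun q => v.1 ∈ starLeaves q ∧ u.1 ∈ starLeaves q)).card : ℕ) : R) * φ (some u) =
      ∑ q ∈ starCentres v.1, if q ∈ F.toRight then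
        (if u.1 ∈ starLeaves q then Φ u.1 else 0) else 0 := by
    intro u
    rw [hin]
    -- There are no loops, but `v` is a leaf of each of its stars; the diagonal terms agree because
    -- `Φ v = 0`.
    split_ifs with huv
    · subst huv
      simp [hv]
    · rw [← nsmul_eq_mul, ← sum_const, ← sum_filter, ← sum_filter, filter_filter]
      refine sum_congr ?_ fun _ _ => rfl
      ext q
      simp only [mem_filter, mem_starCentres_iff]
      tauto
  rw [sum_congr rfl fun u _ => hterm u, sum_comm, Nat.cast_sum, sum_mul, ← sum_add_distrib]
  refine sum_congr rfl fun q _ => ?_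
  by_cases hq : q ∈ F.toRight
  · simp only [if_pos hq]
    rw [sum_coe_sort F.toLeft (fun u => if u ∈ starLeaves q then Φ u else 0), ← sum_filter,
      ← sum_filter_not_add_sum_filter (starLeaves q) (· ∈ F.toLeft) Φ]
    congr 1
    · rw [sum_congr rfl fun y hy => hout y (mem_filter.1 hy).2, sum_const, nsmul_eq_mul]
    · exact sum_congr (by ext y; simp [and_comm]) fun _ _ => rfl
  · simp only [if_neg hq, sum_const_zero, add_zero]

theorem honeycombSandpile_degree (x : F) : (honeycombSandpile F).degree (some x) = 3 := by
  have := honeycombSandpile_sum_mult x (fun _ => 1) (fun _ => 1) (fun _ => rfl) (fun _ _ => rfl)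
  simpa [degree, card_honeycombNbrs] using this

theorem starDeltaSandpile_degree (r : ℕ) (v : F.toLeft) :
    (starDeltaSandpile r F).degree (some v) =
      ∑ q ∈ starCentres v.1, if q ∈ F.toRight then 2 else r := by
  have := starDeltaSandpile_sum_mult r v (fun u => if u = some v then 0 else 1)
    (fun u => if u = v.1 then 0 else 1)
    (fun u => by simp only [Option.some_inj, Subtype.ext_iff])
    (fun u hu => by
      have : u ≠ v.1 := fun h => hu (h ▸ v.2)
      simp [this]) (by simp)
  rw [degree]
  refine Eq.trans (sum_congr rfl fun u _ => ?_) (this.trans (sum_congr rfl fun q hq => ?_))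
  · by_cases hu : u = some v
    · simp [hu, SinkGraph.mult_self]
    · simp [hu]
  · rw [mem_starCentres_iff] at hq
    congr 1
    · rw [sum_ite, sum_const_zero, zero_add, sum_const, smul_eq_mul, mul_one, filter_ne',
        card_erase_of_mem hq, card_starLeaves]
    · simp

theorem starDeltaSandpile_degree_le (r : ℕ) (v : F.toLeft) :
    (starDeltaSandpile r F).degree (some v) ≤ 6 + 3 * r := by
  rw [starDeltaSandpile_degree]
  refine (sum_le_card_nsmul _ _ (2 + r) fun q _ => ?_).trans ?_
  · split_ifs <;> omega
  · rw [card_starCentres, smul_eq_mul]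
    omega

theorem two_le_starDeltaSandpile_degree {r : ℕ} (hr : 1 ≤ r) (v : F.toLeft) :
    2 ≤ (starDeltaSandpile r F).degree (some v) := by
  rw [starDeltaSandpile_degree]
  refine le_trans ?_ (card_nsmul_le_sum _ _ 1 fun q _ => ?_)
  · rw [card_starCentres]
    simp
  · split_ifs <;> omega

theorem honeycombSandpile_lap (G : HoneycombSite → ℝ) (hG : ∀ x, x ∉ F → G x = 0) (x : F) :
    (honeycombSandpile F).lap (fun o => o.elim 0 fun y => G y.1) (some x) =
      ∑ y ∈ honeycombNbrs x.1, (G x.1 - G y) := by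
  rw [lap_eq_sum]
  exact honeycombSandpile_sum_mult x _ (fun y => G x.1 - G y) (fun _ => rfl)
    (fun y hy => by simp [hG y hy])

theorem starDeltaSandpile_lap (r : ℕ) (g : ℤ × ℤ → ℝ) (hg : ∀ v, v ∉ F.toLeft → g v = 0)
    (v : F.toLeft) :
    (starDeltaSandpile r F).lap (fun o => o.elim 0 fun y => g y.1) (some v) =
      ∑ q ∈ starCentres v.1,
        if q ∈ F.toRight then ∑ u ∈ starLeaves q, (g v.1 - g u) else r * g v.1 := by
  rw [lap_eq_sum, starDeltaSandpile_sum_mult r v _ (fun y => g v.1 - g y) (fun _ => rfl)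
    (fun y hy => by simp [hg y hy]) (by simp)]
  simp

/-- The star-delta transformation preserves the potentials at the left vertices. -/
theorem starDeltaSandpile_isPotential {a : ℤ × ℤ} (ha : Sum.inl a ∈ F) {p : Option F → ℝ}
    (hp : (honeycombSandpile F).IsPotential (some ⟨Sum.inl a, ha⟩) p) :
    (starDeltaSandpile 3 F).IsPotential (some ⟨a, mem_toLeft.2 ha⟩)
      (fun o => o.elim 0 fun v => p (some ⟨Sum.inl v.1, mem_toLeft.1 v.2⟩)) := by
  obtain ⟨h0, h1, h⟩ := isPotential_iff.1 hp
  let G : HoneycombSite → ℝ := fun x => if hx : x ∈ F then p (some ⟨x, hx⟩) else 0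
  have hG : ∀ x, x ∉ F → G x = 0 := fun x hx => by simp [G, hx]
  have hpG : p = fun o => o.elim 0 fun y => G y.1 := by
    funext o
    obtain _ | y := o
    · exact h0
    · simp [G]
  have hharm : ∀ x (hx : x ∈ F), x ≠ Sum.inl a → ∑ y ∈ honeycombNbrs x, (G x - G y) = 0 := by
    intro x hx hxa
    have := h (some ⟨x, hx⟩) (Option.some_ne_none _) (fun e => hxa (by simpa using e))
    rwa [hpG, honeycombSandpile_lap G hG] at this
  have hq : (fun o : Option F.toLeft =>
      o.elim 0 fun v => p (some ⟨Sum.inl v.1, mem_toLeft.1 v.2⟩)) =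
      fun o => o.elim 0 fun v => G (Sum.inl v.1) := by
    rw [hpG]
    rfl
  refine isPotential_iff.2 ⟨rfl, h1, fun v hv hva => ?_⟩
  obtain _ | v := v
  · exact absurd rfl hv
  rw [hq, starDeltaSandpile_lap 3 (fun v => G (Sum.inl v))
    (fun v hv => hG _ (fun h => hv (mem_toLeft.2 h)))]
  have hvF : Sum.inl v.1 ∈ F := mem_toLeft.1 v.2
  have hL := hharm (Sum.inl v.1) hvF (fun e => hva (by
    rw [Option.some_inj]; exact Subtype.ext (Sum.inl_injective e)))
  simp only [honeycombNbrs, sum_map, Function.Embedding.inr_apply] at hL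
  -- Three times the honeycomb Laplacian is matched star by star. At a centre in `F`, harmonicity
  -- says that `3 * G q` is the sum over the leaves; at a centre outside, `G q = 0` and the term is
  -- that of three edges to the sink.
  rw [← mul_zero (3 : ℝ), ← hL, mul_sum]
  refine sum_congr rfl fun q _ => ?_
  by_cases hqF : q ∈ F.toRight
  · have hR := hharm (Sum.inr q) (mem_toRight.1 hqF) (by simp)
    simp only [honeycombNbrs, sum_map, Function.Embedding.inl_apply, sum_sub_distrib, sum_const,
      card_map, card_starLeaves, nsmul_eq_mul] at hR
    rw [if_pos hqF]
    simp only [sum_sub_distrib, sum_const, card_starLeaves, nsmul_eq_mul]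
    push_cast at hR ⊢
    linarith
  · rw [if_neg hqF, hG (Sum.inr q) (fun h => hqF (mem_toRight.2 h))]
    push_cast
    ring

end Section

section Bounds

variable {F : Finset HoneycombSite}

/-! ### Comparison of the transience classes -/

theorem card_site_honeycombSandpile :
    Fintype.card (honeycombSandpile F).Site = F.card := by
  rw [card_site, Fintype.card_option, Fintype.card_coe, Nat.add_sub_cancel]

theorem card_site_starDeltaSandpile (r : ℕ) :
    Fintype.card (starDeltaSandpile r F).Site = F.toLeft.card := by
  rw [card_site, Fintype.card_option, Fintype.card_coe, Nat.add_sub_cancel]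

theorem starDeltaSandpile_mult_sink (r : ℕ) (v : F.toLeft) :
    (starDeltaSandpile r F).mult (some v) (starDeltaSandpile r F).sink =
      ∑ q ∈ starCentres v.1,
        if q ∈ F.toRight then ((starLeaves q).filter (· ∉ F.toLeft)).card else r :=
  rfl

theorem honeycombSandpile_degree_site {v : Option F} (hv : v ≠ (honeycombSandpile F).sink) :
    (honeycombSandpile F).degree v = 3 := by
  obtain _ | x := v
  · exact absurd rfl hv
  · exact honeycombSandpile_degree x

theorem starDeltaSandpile_degree_site_le {r : ℕ} {v : Option F.toLeft}
    (hv : v ≠ (starDeltaSandpile r F).sink) : (starDeltaSandpile r F).degree v ≤ 6 + 3 * r := by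
  obtain _ | x := v
  · exact absurd rfl hv
  · exact starDeltaSandpile_degree_le r x

/-- The potentials for different numbers of parallel edges at the boundary are polynomially
related. -/
theorem starDeltaSandpile_potential_pow_le {r s : ℕ} (hr : 1 ≤ r) (hs : 1 ≤ s)
    (hF : (honeycomb.induce (F : Set HoneycombSite)).Connected) (hne : F.toLeft.Nonempty)
    {w : Option F.toLeft} (hw : w ≠ none) {p q : Option F.toLeft → ℝ}
    (hp : (starDeltaSandpile r F).IsPotential w p) (hq : (starDeltaSandpile s F).IsPotential w q)
    (v : Option F.toLeft) : p v ^ s ≤ q v := by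
  have hc1 := starDeltaSandpile_isConnected le_rfl hF hne
  have hcr := starDeltaSandpile_isConnected hr hF hne
  have hcs := starDeltaSandpile_isConnected hs hF hne
  -- The network with `r = 1` is an intermediary: `p ≤ p₁` and `p₁ ^ s ≤ q`.
  obtain ⟨p₁, hp₁⟩ := exists_isPotential hc1 hw
  have hm : ∀ (t : ℕ) (u v : Option F.toLeft), u ≠ (starDeltaSandpile 1 F).sink →
      v ≠ (starDeltaSandpile 1 F).sink →
      (starDeltaSandpile t F).mult u v = (starDeltaSandpile 1 F).mult u v := by
    intro t u v hu hv
    obtain _ | u := u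
    · exact absurd rfl hu
    obtain _ | v := v
    · exact absurd rfl hv
    rfl
  have hmono : ∀ v, (starDeltaSandpile 1 F).mult v (starDeltaSandpile 1 F).sink ≤
      (starDeltaSandpile r F).mult v (starDeltaSandpile r F).sink := by
    intro v
    obtain _ | v := v
    · exact le_rfl
    · rw [starDeltaSandpile_mult_sink, starDeltaSandpile_mult_sink]
      refine sum_le_sum fun q _ => ?_
      split_ifs
      · exact le_rfl
      · exact hr
  have hmul : ∀ v, (starDeltaSandpile s F).mult v (starDeltaSandpile s F).sink ≤
      s * (starDeltaSandpile 1 F).mult v (starDeltaSandpile 1 F).sink := by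
    intro v
    obtain _ | v := v
    · exact Nat.zero_le _
    · rw [starDeltaSandpile_mult_sink, starDeltaSandpile_mult_sink, mul_sum]
      refine sum_le_sum fun q _ => ?_
      split_ifs
      · exact Nat.le_mul_of_pos_left _ hs
      · rw [mul_one]
  have h1 := hp₁.le_of_sink_mult_le (T := starDeltaSandpile r F) hc1 rfl hcr (hm r) hmono hp v
  have h2 := hp₁.pow_le_of_sink_mult_le (T := starDeltaSandpile s F) hc1 rfl hcs (hm s) hs hmul hq v
  exact (pow_le_pow_left₀ (hp.nonneg hcr v) h1 s).trans h2

/-- The bound `1 / (3 * (K + 1))` for honeycomb potentials is raised to the power `r`; the extra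
factor `K + 1` comes from the number of sites. -/
theorem tcl_starDeltaSandpile_le {r : ℕ} (hr : 1 ≤ r)
    (hF : (honeycomb.induce (F : Set HoneycombSite)).Connected) {K : ℕ}
    (hK : (honeycombSandpile F).tcl ≤ (K : ℕ∞)) :
    (starDeltaSandpile r F).tcl ≤ ((3 ^ r * (6 + 3 * r) * 2 * (K + 1) ^ (r + 1) : ℕ) : ℕ∞) := by
  rcases F.toLeft.eq_empty_or_nonempty with he | hne
  · have : IsEmpty (starDeltaSandpile r F).Site := by
      rw [← Fintype.card_eq_zero_iff, card_site_starDeltaSandpile, he, card_empty]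
    refine tcl_le fun k c hrun => absurd (fun c' => ?_) hrun.not_isRecurrent
    rw [Subsingleton.elim c c']
    exact ⟨c', le_rfl, Relation.ReflTransGen.refl⟩
  have hH := honeycombSandpile_isConnected hF
  have hHO := honeycombSandpile_ordinaryConnected hF
  have hT := starDeltaSandpile_isConnected hr hF hne
  have hpot : ∀ w v p, w ≠ (starDeltaSandpile r F).sink → v ≠ (starDeltaSandpile r F).sink →
      (starDeltaSandpile r F).IsPotential w p → 1 ≤ (((3 * (K + 1)) ^ r : ℕ) : ℝ) * p v := by
    intro w v p hw hv hp
    obtain _ | w := w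
    · exact absurd rfl hw
    obtain _ | v := v
    · exact absurd rfl hv
    obtain ⟨P, hP⟩ := exists_isPotential hH
      (w := some ⟨Sum.inl w.1, mem_toLeft.1 w.2⟩) (Option.some_ne_none _)
    have h1 := one_le_mul_potential hH hHO hK (fun v hv => (honeycombSandpile_degree_site hv).le)
      (Option.some_ne_none _) (v := some ⟨Sum.inl v.1, mem_toLeft.1 v.2⟩)
      (Option.some_ne_none _) hP
    have h2 := starDeltaSandpile_potential_pow_le (r := 3) (s := r) (by norm_num) hr hF hne
      (Option.some_ne_none _) (starDeltaSandpile_isPotential _ hP) hp (some v)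
    refine (one_le_pow₀ h1 (n := r)).trans ?_
    rw [mul_pow]
    push_cast
    exact mul_le_mul_of_nonneg_left h2 (by positivity)
  refine (tcl_le_of_potential hT hpot).trans ?_
  have hcard : F.toLeft.card ≤ K + 2 := by
    have h1 := card_site_le hHO (fun v => by rw [honeycombSandpile_degree_site v.2]; norm_num) hK
    rw [card_site_honeycombSandpile] at h1
    exact card_toLeft_le.trans h1
  have hsum : ∑ v : (starDeltaSandpile r F).Site, (starDeltaSandpile r F).degree v.1 ≤
      (K + 2) * (6 + 3 * r) := by
    refine (sum_le_card_nsmul _ _ _ fun v _ => starDeltaSandpile_degree_site_le v.2).trans ?_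
    rw [card_univ, card_site_starDeltaSandpile, smul_eq_mul]
    exact Nat.mul_le_mul_right _ hcard
  have : (3 * (K + 1)) ^ r * ∑ v : (starDeltaSandpile r F).Site, (starDeltaSandpile r F).degree v.1
      ≤ 3 ^ r * (6 + 3 * r) * 2 * (K + 1) ^ (r + 1) := by
    calc _ ≤ (3 * (K + 1)) ^ r * ((2 * (K + 1)) * (6 + 3 * r)) :=
          Nat.mul_le_mul_left _ (hsum.trans (Nat.mul_le_mul_right _ (by omega)))
      _ = _ := by rw [mul_pow, pow_succ]; ring
  exact_mod_cast this

/-- In a connected section with at least two vertices every centre has a leaf in the section. -/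
theorem exists_leaf_of_mem_toRight (hF : (honeycomb.induce (F : Set HoneycombSite)).Connected)
    (hnt : Nontrivial F) {q : ℤ × ℤ} (hq : q ∈ F.toRight) :
    ∃ p ∈ starLeaves q, p ∈ F.toLeft := by
  have : Nontrivial (F : Set HoneycombSite) := hnt
  obtain ⟨⟨y, hy⟩, hadj⟩ := hF.preconnected.exists_adj_of_nontrivial ⟨Sum.inr q, mem_toRight.1 hq⟩
  have hadj' : y ∈ honeycombNbrs (Sum.inr q) := hadj
  simp only [honeycombNbrs, mem_map, Function.Embedding.inl_apply] at hadj'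
  obtain ⟨p, hp, rfl⟩ := hadj'
  exact ⟨p, hp, mem_toLeft.2 hy⟩

theorem card_le_four_mul_card_toLeft
    (hF : (honeycomb.induce (F : Set HoneycombSite)).Connected) (hnt : Nontrivial F) :
    F.card ≤ 4 * F.toLeft.card := by
  have hsub : F.toRight ⊆ F.toLeft.biUnion starCentres := by
    intro q hq
    obtain ⟨p, hp, hpF⟩ := exists_leaf_of_mem_toRight hF hnt hq
    exact mem_biUnion.2 ⟨p, hpF, (mem_starCentres_iff p q).2 hp⟩
  have h1 := (card_le_card hsub).trans
    (card_biUnion_le_card_mul _ _ 3 fun p _ => (card_starCentres p).le)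
  have h2 := card_toLeft_add_card_toRight (u := F)
  omega

/-- Lower bounds for the honeycomb potentials at the left vertices imply lower bounds
everywhere. -/
theorem honeycombSandpile_potential_ge
    (hF : (honeycomb.induce (F : Set HoneycombSite)).Connected) (hnt : Nontrivial F) {M : ℝ}
    (hM0 : 0 ≤ M)
    (hM : ∀ (a b : ℤ × ℤ) (ha : Sum.inl a ∈ F) (hb : Sum.inl b ∈ F) (p : Option F → ℝ),
      (honeycombSandpile F).IsPotential (some ⟨Sum.inl a, ha⟩) p → 1 ≤ M * p (some ⟨Sum.inl b, hb⟩))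
    {w v : Option F} {p : Option F → ℝ} (hw : w ≠ none) (hv : v ≠ none)
    (hp : (honeycombSandpile F).IsPotential w p) : 1 ≤ 9 * M * p v := by
  have hH := honeycombSandpile_isConnected hF
  -- Every vertex is at most one edge from a left vertex. Moving the target costs a factor 3, and so
  -- does moving the source, by the Markov property.
  have hnear : ∀ x : F, ∃ (b : ℤ × ℤ) (hb : Sum.inl b ∈ F), x = ⟨Sum.inl b, hb⟩ ∨
      0 < (honeycombSandpile F).mult (some x) (some ⟨Sum.inl b, hb⟩) := by
    rintro ⟨b | q, hx⟩
    · exact ⟨b, hx, Or.inl rfl⟩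
    · obtain ⟨b, hbq, hb⟩ := exists_leaf_of_mem_toRight hF hnt (mem_toRight.2 hx)
      refine ⟨b, mem_toLeft.1 hb, Or.inr ?_⟩
      change 0 < if Sum.inl b ∈ honeycombNbrs (Sum.inr q) then 1 else 0
      rw [if_pos (by simpa [honeycombNbrs] using hbq)]
      exact one_pos
  have hedge : ∀ (x y : F) (w : Option F) (p : Option F → ℝ),
      (honeycombSandpile F).IsPotential w p → some x ≠ w →
      0 < (honeycombSandpile F).mult (some x) (some y) → p (some y) ≤ 3 * p (some x) := by
    intro x y w p hp hxw hxy
    have := hp.mul_le_degree_mul hH (Option.some_ne_none _) hxw hxy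
    rwa [honeycombSandpile_degree] at this
  have hleft : ∀ (a : ℤ × ℤ) (ha : Sum.inl a ∈ F) (x : F) (p : Option F → ℝ),
      (honeycombSandpile F).IsPotential (some ⟨Sum.inl a, ha⟩) p → 1 ≤ 3 * M * p (some x) := by
    intro a ha x p hp
    obtain ⟨b, hb, hbx⟩ := hnear x
    have hb1 := hM a b ha hb p hp
    rcases hbx with rfl | hbx
    · linarith
    by_cases hxa : some x = some ⟨Sum.inl a, ha⟩
    · have := hM a a ha ha p hp
      rw [hxa]
      linarith
    calc (1 : ℝ) ≤ M * p (some ⟨Sum.inl b, hb⟩) := hb1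
      _ ≤ M * (3 * p (some x)) := mul_le_mul_of_nonneg_left (hedge x _ _ p hp hxa hbx) hM0
      _ = 3 * M * p (some x) := by ring
  obtain _ | w := w
  · exact absurd rfl hw
  obtain _ | v := v
  · exact absurd rfl hv
  obtain ⟨a, ha, haw⟩ := hnear w
  obtain ⟨P, hP⟩ := exists_isPotential hH (w := some ⟨Sum.inl a, ha⟩) (Option.some_ne_none _)
  have hmarkov := hp.mul_le hH hP (some v)
  have hPv := hleft a ha v P hP
  have hstep : 1 ≤ 3 * p (some ⟨Sum.inl a, ha⟩) := by
    rcases haw with rfl | haw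
    · rw [hp.2.1]
      norm_num
    · have hne : some ⟨Sum.inl a, ha⟩ ≠ some w := fun e => by
        rw [e, SinkGraph.mult_self] at haw
        exact lt_irrefl _ haw
      have := hedge ⟨Sum.inl a, ha⟩ w (some w) p hp hne (by rwa [SinkGraph.mult_comm])
      rwa [hp.2.1] at this
  have hP0 := hP.nonneg hH (some v)
  calc (1 : ℝ) ≤ 3 * M * P (some v) := hPv
    _ ≤ 3 * M * P (some v) * (3 * p (some ⟨Sum.inl a, ha⟩)) :=
        le_mul_of_one_le_right (by positivity) hstep
    _ = 9 * M * (p (some ⟨Sum.inl a, ha⟩) * P (some v)) := by ring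
    _ ≤ 9 * M * p (some v) := mul_le_mul_of_nonneg_left hmarkov (by positivity)

theorem tcl_honeycombSandpile_le {r : ℕ} (hr : 1 ≤ r)
    (hF : (honeycomb.induce (F : Set HoneycombSite)).Connected) {K : ℕ}
    (hK : (starDeltaSandpile r F).tcl ≤ (K : ℕ∞)) :
    (honeycombSandpile F).tcl ≤ ((216 * (6 + 3 * r) ^ 3 * (K + 1) ^ 4 : ℕ) : ℕ∞) := by
  have hH := honeycombSandpile_isConnected hF
  have hsum : ∑ v : (honeycombSandpile F).Site, (honeycombSandpile F).degree v.1 = 3 * F.card := by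
    rw [sum_congr rfl fun v _ => honeycombSandpile_degree_site v.2, sum_const, card_univ,
      card_site_honeycombSandpile, smul_eq_mul, mul_comm]
  -- An isolated centre leaves no sites after the star-delta transformation, so one-vertex sections
  -- are treated directly.
  rcases subsingleton_or_nontrivial F with hsub | hnt
  · refine (tcl_le_of_subsingleton hH fun u v hu hv => ?_).trans ?_
    · obtain _ | u := u
      · exact absurd rfl hu
      obtain _ | v := v
      · exact absurd rfl hv
      rw [Subsingleton.elim u v]
    · have hcard : F.card ≤ 1 := by
        rw [← Fintype.card_coe]
        exact Fintype.card_le_one_iff_subsingleton.2 hsub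
      have h1 : 1 ≤ (6 + 3 * r) ^ 3 * (K + 1) ^ 4 := Nat.mul_pos (by positivity) (by positivity)
      have : 3 * F.card ≤ 216 * (6 + 3 * r) ^ 3 * (K + 1) ^ 4 := by
        rw [mul_assoc]
        omega
      rw [hsum]
      exact_mod_cast this
  have hcard := card_le_four_mul_card_toLeft hF hnt
  have hne : F.toLeft.Nonempty := by
    rw [← card_pos]
    have : 0 < F.card := card_pos.2 ⟨_, hnt.to_nonempty.some.2⟩
    omega
  have hT := starDeltaSandpile_isConnected hr hF hne
  have hTO := starDeltaSandpile_ordinaryConnected r hF hne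
  have hcardL : F.toLeft.card ≤ K + 2 := by
    have h := card_site_le hTO (fun v => ?_) hK
    · rwa [card_site_starDeltaSandpile] at h
    · obtain ⟨_ | v, hv⟩ := v
      · exact absurd rfl hv
      · exact two_le_starDeltaSandpile_degree hr v
  set D : ℕ := 6 + 3 * r with hD
  have hpot : ∀ w v p, w ≠ (honeycombSandpile F).sink → v ≠ (honeycombSandpile F).sink →
      (honeycombSandpile F).IsPotential w p →
      1 ≤ ((9 * (D * (K + 1)) ^ 3 : ℕ) : ℝ) * p v := by
    intro w v p hw hv hp
    have := honeycombSandpile_potential_ge hF hnt (M := ((D : ℝ) * (K + 1)) ^ 3) (by positivity)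
      (fun a b ha hb P hP => ?_) hw hv hp
    · push_cast
      exact this
    · obtain ⟨q, hq⟩ := exists_isPotential hT (w := some ⟨a, mem_toLeft.2 ha⟩)
        (Option.some_ne_none _)
      have h1 := one_le_mul_potential hT hTO hK (fun v hv => starDeltaSandpile_degree_site_le hv)
        (Option.some_ne_none _) (v := some ⟨b, mem_toLeft.2 hb⟩) (Option.some_ne_none _) hq
      have h2 := starDeltaSandpile_potential_pow_le (r := r) (s := 3) hr (by norm_num) hF hne
        (Option.some_ne_none _) hq (starDeltaSandpile_isPotential ha hP)
        (some ⟨b, mem_toLeft.2 hb⟩)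
      refine (one_le_pow₀ h1 (n := 3)).trans ?_
      rw [mul_pow]
      exact mul_le_mul_of_nonneg_left h2 (by positivity)
  refine (tcl_le_of_potential hH hpot).trans ?_
  have : 9 * (D * (K + 1)) ^ 3 * (3 * F.card) ≤ 216 * D ^ 3 * (K + 1) ^ 4 := by
    calc _ ≤ 9 * (D * (K + 1)) ^ 3 * (3 * (8 * (K + 1))) :=
          Nat.mul_le_mul_left _ (by omega)
      _ = _ := by ring
  rw [hsum]
  exact_mod_cast this

end Bounds

/-! ### The triangular lattice -/

theorem SinkGraph.ofSites_congr {X : Type*} {m m' : X → X → ℕ} {t t' : X → ℕ}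
    {hm : ∀ x y, m x y = m y x} {h0 : ∀ x, m x x = 0} {hm' : ∀ x y, m' x y = m' y x}
    {h0' : ∀ x, m' x x = 0} (h : ∀ x y, m x y = m' x y) (ht : ∀ x, t x = t' x) :
    SinkGraph.ofSites m t hm h0 = SinkGraph.ofSites m' t' hm' h0' := by
  obtain rfl : m = m' := funext fun x => funext (h x)
  obtain rfl : t = t' := funext ht
  rfl

/-- If every centre with at least two leaves in the section belongs to the section, then doubling
the remaining edges to the sink yields the sandpile on a section of the triangular lattice. -/
theorem triangularSandpile_eq_starDeltaSandpile {F : Finset HoneycombSite}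
    (hF : ∀ q : ℤ × ℤ, 2 ≤ ((starLeaves q).filter (fun p => Sum.inl p ∈ F)).card →
      Sum.inr q ∈ F) : triangularSandpile F.toLeft = starDeltaSandpile 2 F := by
  have hmem : ∀ {u v q : ℤ × ℤ}, u ≠ v → u ∈ F.toLeft → v ∈ F.toLeft → u ∈ starLeaves q →
      v ∈ starLeaves q → q ∈ F.toRight := by
    intro u v q huv hu hv huq hvq
    refine mem_toRight.2 (hF q ?_)
    rw [← card_pair huv]
    refine card_le_card fun x hx => ?_
    rw [mem_insert, mem_singleton] at hx
    rcases hx with rfl | rfl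
    · exact mem_filter.2 ⟨huq, mem_toLeft.1 hu⟩
    · exact mem_filter.2 ⟨hvq, mem_toLeft.1 hv⟩
  refine SinkGraph.ofSites_congr (fun u v => ?_) (fun u => ?_)
  · by_cases huv : u = v
    · rw [if_pos huv, huv, if_neg (triangularNbrs_self _)]
    have huv' : u.1 ≠ v.1 := fun h => huv (Subtype.ext h)
    rw [if_neg huv]
    split_ifs with h
    · obtain ⟨-, q, hq, hvq⟩ := (mem_triangularNbrs_iff _ _).1 h
      rw [mem_starCentres_iff] at hq
      refine (card_eq_one.2 ⟨q, ?_⟩).symm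
      ext q'
      rw [mem_filter, mem_singleton]
      constructor
      · rintro ⟨-, h1, h2⟩
        exact eq_of_mem_starLeaves huv' h1 h2 hq hvq
      · rintro rfl
        exact ⟨hmem huv' u.2 v.2 hq hvq, hq, hvq⟩
    · refine (card_eq_zero.2 (filter_eq_empty_iff.2 ?_)).symm
      rintro q - ⟨h1, h2⟩
      exact h ((mem_triangularNbrs_iff _ _).2
        ⟨huv'.symm, q, (mem_starCentres_iff _ _).2 h1, h2⟩)
  -- The three stars at `u` split its six neighbours into disjoint pairs. If a centre is outside
  -- `F`, then `u` is its only leaf inside, so both edges of the pair go to the sink; hence `r = 2`.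
  · rw [triangularNbrs_eq_biUnion, filter_biUnion, card_biUnion]
    · refine sum_congr rfl fun q hq => ?_
      rw [mem_starCentres_iff] at hq
      split_ifs with hqF
      · congr 1
        ext x
        simp only [mem_filter, mem_erase]
        constructor
        · rintro ⟨⟨-, h1⟩, h2⟩
          exact ⟨h1, h2⟩
        · rintro ⟨h1, h2⟩
          exact ⟨⟨fun e => h2 (e ▸ u.2), h1⟩, h2⟩
      · rw [filter_true_of_mem, card_erase_of_mem hq, card_starLeaves]
        intro x hx hxF
        exact hqF (hmem (ne_of_mem_erase hx).symm u.2 hxF hq (mem_of_mem_erase hx))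
    · intro q hq q' hq' hne
      rw [mem_coe, mem_starCentres_iff] at hq hq'
      refine disjoint_left.2 fun x hx hx' => hne ?_
      rw [mem_filter, mem_erase] at hx hx'
      exact eq_of_mem_starLeaves hx.1.1.symm hq hx.1.2 hq' hx'.1.2

theorem inTCLPoly_honeycombSandpile_iff {F : ℕ → Finset HoneycombSite}
    (hF : ∀ n, (honeycomb.induce (F n : Set HoneycombSite)).Connected) {r : ℕ} (hr : 1 ≤ r) :
    InTCLPoly (fun n => honeycombSandpile (F n)) ↔
      InTCLPoly (fun n => starDeltaSandpile r (F n)) := by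
  have h0 : ∃ k C : ℕ, ∀ᶠ n : ℕ in Filter.atTop, (fun _ => 0 : ℕ → ℕ) n ≤ C * n ^ k :=
    ⟨0, 0, Filter.Eventually.of_forall fun _ => Nat.zero_le _⟩
  exact ⟨fun h => h.of_bound _ h0 _ _ fun n _ hK _ => tcl_starDeltaSandpile_le hr (hF n) hK,
    fun h => h.of_bound _ h0 _ _ fun n _ hK _ => tcl_honeycombSandpile_le hr (hF n) hK⟩

end Lattice

theorem mainTheorem10 :
    -- network equivalent families of polynomial size
    (∀ {V : ℕ → Type*} {W : ℕ → Type*} [∀ n, Fintype (V n)] [∀ n, DecidableEq (V n)]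
        [∀ n, Fintype (W n)] [∀ n, DecidableEq (W n)]
        (A : ∀ n, SinkGraph (V n)) (B : ∀ n, SinkGraph (W n)),
      (∀ n, (A n).IsConnected) → (∀ n, (B n).IsConnected) →
      (∀ n, (A n).OrdinaryConnected) → (∀ n, (B n).OrdinaryConnected) →
      SinkGraph.PolySize A → SinkGraph.PolySize B →
      (∀ n, (A n).NetworkEquiv (B n)) →
      (SinkGraph.InTCLPoly A ↔ SinkGraph.InTCLPoly B)) ∧
    -- star-delta: the potentials at the common vertices do not change
    (∀ F : Finset HoneycombSite, (honeycomb.induce (F : Set HoneycombSite)).Connected →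
      ∀ (a : ℤ × ℤ) (ha : Sum.inl a ∈ F), ∃ (p : Option F → ℝ) (q : Option F.toLeft → ℝ),
        (honeycombSandpile F).IsPotential (some ⟨Sum.inl a, ha⟩) p ∧
        (starDeltaSandpile 3 F).IsPotential (some ⟨a, Finset.mem_toLeft.2 ha⟩) q ∧
        ∀ (b : ℤ × ℤ) (hb : Sum.inl b ∈ F),
          p (some ⟨Sum.inl b, hb⟩) = q (some ⟨b, Finset.mem_toLeft.2 hb⟩)) ∧
    -- honeycomb sandpiles and the triangular sandpiles obtained from them
    (∀ F : ℕ → Finset HoneycombSite,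
      (∀ n, (honeycomb.induce (F n : Set HoneycombSite)).Connected) →
      (∀ r : ℕ, 1 ≤ r →
        (SinkGraph.InTCLPoly (fun n => honeycombSandpile (F n)) ↔
          SinkGraph.InTCLPoly (fun n => starDeltaSandpile r (F n)))) ∧
      ((∀ n, ∀ q : ℤ × ℤ, 2 ≤ ((starLeaves q).filter (fun p => Sum.inl p ∈ F n)).card →
          Sum.inr q ∈ F n) →
        (SinkGraph.InTCLPoly (fun n => honeycombSandpile (F n)) ↔
          SinkGraph.InTCLPoly (fun n => triangularSandpile (F n).toLeft)))) := by
  refine ⟨?_, ?_, ?_⟩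
  · intro V W _ _ _ _ A B hA hB hAO hBO hAP hBP h
    exact ⟨SinkGraph.InTCLPoly.of_networkEquiv hA hB hAO hBO hAP hBP h,
      SinkGraph.InTCLPoly.of_networkEquiv hB hA hBO hAO hBP hAP fun n => (h n).symm⟩
  · intro F hF a ha
    obtain ⟨p, hp⟩ := SinkGraph.exists_isPotential (honeycombSandpile_isConnected hF)
      (w := some ⟨Sum.inl a, ha⟩) (Option.some_ne_none _)
    exact ⟨p, _, hp, starDeltaSandpile_isPotential ha hp, fun _ _ => rfl⟩
  · intro F hF
    refine ⟨fun r hr => inTCLPoly_honeycombSandpile_iff hF hr, fun hC => ?_⟩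
    rw [funext fun n => triangularSandpile_eq_starDeltaSandpile (hC n)]
    exact inTCLPoly_honeycombSandpile_iff hF (by norm_num)
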